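/- Let $H$ be a separable (real or complex) Hilbert space and let $A$ be a positive selfadjoint operator in $H$ with a complete orthonormal system of eigenvectors $\{v_k\}_{k\ge 1}$ and eigenvalues $0<\lambda_1\le\lambda_2\le\cdots\to+\infty$. For $h\in H$ write $h_k=(h,v_k)$; for $\tau\in\mathbb R$ let $A^\tau h=\sum_k\lambda_k^\tau h_k v_k$ on $D(A^\tau)=\{h:\sum_k\lambda_k^{2\tau}|h_k|^2<\infty\}$, with the norm $\|h\|_\tau=\|A^\tau h\|$. Let $E_{\rho,\mu}(z)=\sum_{n\ge 0} z^n/\Gamma(\rho n+\mu)$ and $E_\rho=E_{\rho,1}$. For $0<\rho<1$ let $$D_t^\rho h(t)=\frac{d}{dt}\,\frac{1}{\Gamma(1-\rho)}\int_0^t\frac{h(s)-h(0)}{(t-s)^{\rho}}\,ds$$ be the Caputo derivative of a continuous function $h:[0,T]\to H$ (one-sided at $t=T$); for absolutely continuous $h$ it is $\frac{1}{\Gamma(1-\rho)}\int_0^t(t-s)^{-\rho}h'(s)\,ds$ wherever the latter is continuous. Let $0<\rho<1$, $T>0$, $\alpha\in(0,1)$, $\xi_0,\xi_2\in(0,T]$,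 $\xi_2\ne\xi_0$, and let $K_0=\{k: E_\rho(-\lambda_k\xi_0^\rho)=\alpha\}$ (possibly empty). Let $W\in D(A)$ and $f\in C([0,T];D(A^\varepsilon))$ for some $\varepsilon\in(0,1)$, and suppose that $(f(t),v_k)=0$ for all $0<t\le T$ and $k\in K_0$. A function $u\in C([0,T];H)$ with $D_t^\rho u,\ Au\in C((0,T];H)$ is called a solution of the forward problem with $\varphi\in H$ if $$D_t^\rho u(t)+Au(t)=f(t)\quad(0<t\le T),\qquad u(\xi_0)=\alpha u(0)+\varphi .$$ Then there is exactly one pair $\{u,\varphi\}$, $\varphi\in H$, such that $u$ is a solution of the forward problem with $\varphi$ and $u(\xi_2)=W$. It is given by the series, convergent in $H$, $$\varphi=\sum_{k\notin K_0}\left[\frac{E_\rho(-\lambda_k\xi_0^\rho)-\alpha}{E_\rho(-\lambda_k\xi_2^\rho)}\,[W_k-\omega_k(\xi_2)]+\omega_k(\xi_0)\right]v_k,$$ $$u(t)=\sum_{k\notin K_0}\left[\frac{\varphi_k-\omega_k(\xi_0)}{E_\rho(-\lambda_k\xi_0^\rho)-\alpha}\,E_\rho(-\lambda_k t^\rho)+\omega_k(t)\right]v_k+\sum_{k\in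 K_0}\frac{E_\rho(-\lambda_k t^\rho)\,W_k}{E_\rho(-\lambda_k\xi_2^\rho)}\,v_k,\qquad 0\le t\le T,$$ where $$\omega_k(t)=\int_0^t\eta^{\rho-1}E_{\rho,\rho}(-\lambda_k\eta^\rho)f_k(t-\eta)\,d\eta .$$ In particular $u$ is unique, although, if $K_0\neq\emptyset$, the forward problem is not uniquely solvable: whenever it has a solution $u$ for some $\varphi\in H$, it has another solution for the same $\varphi$. -/

import Mathlib

open Set Filter Topology MeasureTheory

noncomputable section

namespace Subdiffusion

/-- The two-parameter Mittag-Leffler function `E_{ρ,μ}(z) = ∑ zⁿ / Γ(ρ n + μ)` (real arguments). -/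
def mittagLeffler (ρ μ z : ℝ) : ℝ :=
  ∑' n : ℕ, z ^ n / Real.Gamma (ρ * n + μ)

section Caputo

variable {H : Type*} [NormedAddCommGroup H] [NormedSpace ℝ H]

/-- The Riemann-Liouville fractional integral
`(I^μ h)(t) = Γ(μ)⁻¹ ∫₀ᵗ (t - s)^(μ - 1) h(s) ds` of a vector-valued function. -/
def fracIntegral (μ : ℝ) (h : ℝ → H) (t : ℝ) : H :=
  (Real.Gamma μ)⁻¹ • ∫ s in (0 : ℝ)..t, (t - s) ^ (μ - 1) • h s

/-- `d` is the Caputo derivative of order `ρ ∈ (0, 1)` at `t ∈ (0, T]` of a function `h`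
on `[0, T]`: the (strong) derivative at `t` of `I^(1 - ρ) (h - h(0))`, one-sided at `t = T`.
For absolutely continuous `h` this is `Γ(1 - ρ)⁻¹ ∫₀ᵗ (t - s)^(-ρ) h'(s) ds`
(where the latter is continuous); for functions that are only continuous it is the meaning
of this expression, with `h'` the distributional derivative. -/
def HasCaputoDeriv (ρ T : ℝ) (h : ℝ → H) (d : H) (t : ℝ) : Prop :=
  HasDerivWithinAt (fracIntegral (1 - ρ) fun s => h s - h 0) d (Icc 0 T) t

end Caputo

section Problem

variable {𝕜 H : Type*} [RCLike 𝕜] [NormedAddCommGroup H] [InnerProductSpace 𝕜 H]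

/-- The domain `D(A^τ)` of the power `A^τ` of the operator with eigenvalues `lam k` and
eigenvectors `v k`. -/
def powDomain (lam : ℕ → ℝ) (v : HilbertBasis ℕ 𝕜 H) (τ : ℝ) : Set H :=
  {h | Summable fun k => lam k ^ (2 * τ) * ‖inner 𝕜 (v k) h‖ ^ 2}

/-- The power `A^τ h = ∑ λ_k^τ h_k v_k`, for `h ∈ D(A^τ)`. -/
def pow (lam : ℕ → ℝ) (v : HilbertBasis ℕ 𝕜 H) (τ : ℝ) (h : H) : H :=
  ∑' k, (((lam k ^ τ : ℝ) : 𝕜) * inner 𝕜 (v k) h) • v k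

/-- `f ∈ C([0, T]; D(A^τ))`. The norm of `D(A^τ)` is `‖h‖_τ = ‖A^τ h‖`, so continuity in
`D(A^τ)` is continuity of `A^τ f` in `H`. -/
def ContinuousInPowDomain (lam : ℕ → ℝ) (v : HilbertBasis ℕ 𝕜 H) (τ T : ℝ) (f : ℝ → H) : Prop :=
  (∀ t ∈ Icc 0 T, f t ∈ powDomain lam v τ) ∧
    ContinuousOn (fun t => pow lam v τ (f t)) (Icc 0 T)

/-- The set `K₀` of the critical indices: those `k` with `E_ρ(-λ_k ξ₀^ρ) = α`. -/
def criticalSet (ρ α ξ₀ : ℝ) (lam : ℕ → ℝ) : Set ℕ :=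
  {k | mittagLeffler ρ 1 (-(lam k) * ξ₀ ^ ρ) = α}

/-- `ω_k(t) = ∫₀ᵗ η^(ρ - 1) E_{ρ,ρ}(-λ_k η^ρ) f_k(t - η) dη`, where `f_k(t) = (f(t), v_k)`. -/
def duhamel (ρ : ℝ) (lam : ℕ → ℝ) (v : HilbertBasis ℕ 𝕜 H) (f : ℝ → H) (k : ℕ) (t : ℝ) : 𝕜 :=
  ∫ η in (0 : ℝ)..t,
    ((η ^ (ρ - 1) * mittagLeffler ρ ρ (-(lam k) * η ^ ρ) : ℝ) : 𝕜) * inner 𝕜 (v k) (f (t - η))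

/-- `u` solves the forward problem with the data `f`, `φ`: `u ∈ C([0, T]; H)`,
`D_t^ρ u, A u ∈ C((0, T]; H)`, `D_t^ρ u(t) + A u(t) = f(t)` for `0 < t ≤ T`, and
`u(ξ₀) = α u(0) + φ`. -/
structure IsForwardSolution [NormedSpace ℝ H] (A : H →ₗ.[𝕜] H) (ρ T α ξ₀ : ℝ) (f : ℝ → H)
    (u : ℝ → H) (φ : H) : Prop where
  continuousOn : ContinuousOn u (Icc 0 T)
  equation : ∃ Du Au : ℝ → H, ContinuousOn Du (Ioc 0 T) ∧ ContinuousOn Au (Ioc 0 T) ∧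
    ∀ t ∈ Ioc 0 T, HasCaputoDeriv ρ T u (Du t) t ∧ (u t, Au t) ∈ A.graph ∧ Du t + Au t = f t
  nonlocal_condition : u ξ₀ = (α : 𝕜) • u 0 + φ

/-- The pair `u`, `φ` solves the inverse problem: `u` solves the forward problem with `φ` in
the nonlocal condition, and `u(ξ₂) = W`. -/
structure IsInverseSolution [NormedSpace ℝ H] (A : H →ₗ.[𝕜] H) (ρ T α ξ₀ ξ₂ : ℝ) (f : ℝ → H)
    (W : H) (u : ℝ → H) (φ : H) : Prop where
  forward : IsForwardSolution A ρ T α ξ₀ f u φ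
  observation : u ξ₂ = W

/-- The Fourier coefficients of the `φ`-series, for `k ∉ K₀`. -/
def phiCoeff (ρ α ξ₀ ξ₂ : ℝ) (lam : ℕ → ℝ) (v : HilbertBasis ℕ 𝕜 H) (f : ℝ → H) (W : H)
    (k : ℕ) : 𝕜 :=
  ((mittagLeffler ρ 1 (-(lam k) * ξ₀ ^ ρ) - α) / mittagLeffler ρ 1 (-(lam k) * ξ₂ ^ ρ) : ℝ)
      * (inner 𝕜 (v k) W - duhamel ρ lam v f k ξ₂)
    + duhamel ρ lam v f k ξ₀

open Classical in
/-- The Fourier coefficients of the `u`-series at time `t`, for `k ∈ K₀` and for `k ∉ K₀`. -/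
def uCoeff (ρ α ξ₀ ξ₂ : ℝ) (lam : ℕ → ℝ) (v : HilbertBasis ℕ 𝕜 H) (f : ℝ → H) (W φ : H)
    (t : ℝ) (k : ℕ) : 𝕜 :=
  if k ∈ criticalSet ρ α ξ₀ lam then
    ((mittagLeffler ρ 1 (-(lam k) * t ^ ρ) : ℝ) : 𝕜) * inner 𝕜 (v k) W
      / ((mittagLeffler ρ 1 (-(lam k) * ξ₂ ^ ρ) : ℝ) : 𝕜)
  else
    (inner 𝕜 (v k) φ - duhamel ρ lam v f k ξ₀)
        / ((mittagLeffler ρ 1 (-(lam k) * ξ₀ ^ ρ) - α : ℝ) : 𝕜)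
        * ((mittagLeffler ρ 1 (-(lam k) * t ^ ρ) : ℝ) : 𝕜)
      + duhamel ρ lam v f k t

end Problem

end Subdiffusion

end

/-!
The operator is diagonal in the basis `v`, so everything rests on the scalar equation
`D_t^ρ y + λ y = h` together with bounds that are uniform in `λ`. Write `k_μ(t) = t^(μ-1) / Γ(μ)`,
`e(t) = E_ρ(-λ t^ρ)` (`relax`), `g(t) = t^(ρ-1) E_{ρ,ρ}(-λ t^ρ)` (`relaxKernel`), and `*` for
convolution on `[0, t]` (`conv`). Termwise integration of the Mittag-Leffler series gives
`k_{1-ρ} * g = e` and `λ (1 * g) = 1 - e`. By associativity of `*`, convolving the integrated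
equation `k_{1-ρ} * z + λ (1 * z) = 1 * w` with `g` yields `1 * z = 1 * (g * w)`, hence `z = g * w`
(`eqOn_conv_relaxKernel`). This is both uniqueness for the scalar problem and Duhamel's formula
`y = y(0) e + g * h`.

The same uniqueness result proves `t g(t) = ρ (g * e)(t)` (`mul_relaxKernel_eq_conv`), which
replaces the complete monotonicity and the asymptotics of the Mittag-Leffler functions. At a first
zero of `g` the right-hand side would be positive, so `g > 0`, and `e = k_{1-ρ} * g > 0`. Then
`e` decreases from `1`, `λ t g ≤ 1`, `λ e ≤ C t^(-ρ)`, `1 / e ≤ 1 + Γ(1-ρ) λ t^ρ`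
(`inv_relax_le`), and, interpolating, `λ g ≤ C λ^ε t^(ρ ε - 1)` (`exists_lam_mul_relaxKernel_le`).

In `H`, a solution with `u(ξ₂) = W` must have the coefficients `c_k e_k(t) + ω_k(t)`, where
`c_k = (W_k - ω_k(ξ₂)) / e_k(ξ₂)`; this is uniqueness. For existence, the bound on `g` makes the
tails of `∑ λ_k ω_k(t) v_k` uniformly small (`uniformSqTail_lam_mul_duhamel`), and the bound on
`1 / e` together with `W ∈ D(A)` makes `(c_k)` square summable (`summable_norm_initCoeff_sq`). The
series for `u` then converges uniformly, the one for `A u` locally uniformly on `(0, T]` with an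
integrable singularity `t^(-ρ)` at `0`, and the Caputo equation follows in integrated form from its
Fourier coefficients (`exists_solution`). The formula for `c_k` does not distinguish the critical
indices: there `ω_k = 0` and `e_k(ξ₀) = α`, so `φ_k = (e_k(ξ₀) - α) c_k + ω_k(ξ₀)` vanishes
whatever `c_k` is. This also shows that, for critical `k`, the mode `e_k(t) v_k` can be added to any
solution of the forward problem without changing `φ`.
-/

noncomputable section

namespace Subdiffusion

/-! ### One-sided convolution -/

section Conv

variable {E : Type*} [NormedAddCommGroup E] [NormedSpace ℝ E]

/-- The one-sided (Volterra) convolution `(a * h)(t) = ∫₀ᵗ a(s) h(t - s) ds` of a scalar kernel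
with a vector-valued function. Only the values on `[0, t]` matter. -/
def conv (a : ℝ → ℝ) (h : ℝ → E) (t : ℝ) : E :=
  ∫ s in (0 : ℝ)..t, a s • h (t - s)

@[simp] lemma conv_zero_right (a : ℝ → ℝ) (h : ℝ → E) : conv a h 0 = 0 := by
  simp [conv]

lemma conv_congr {a b : ℝ → ℝ} {h k : ℝ → E} {t : ℝ} (ht : 0 ≤ t)
    (hab : ∀ s ∈ Ioo 0 t, a s = b s) (hhk : ∀ s ∈ Ioo 0 t, h s = k s) :
    conv a h t = conv b k t := by
  unfold conv
  rw [intervalIntegral.integral_of_le ht, intervalIntegral.integral_of_le ht,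
    integral_Ioc_eq_integral_Ioo, integral_Ioc_eq_integral_Ioo]
  refine setIntegral_congr_fun measurableSet_Ioo fun s hs => ?_
  have h1 : t - s ∈ Ioo 0 t := ⟨by linarith [hs.2], by linarith [hs.1]⟩
  simp only [hab s hs, hhk _ h1]

lemma conv_comm (a b : ℝ → ℝ) (t : ℝ) : conv a b t = conv b a t := by
  unfold conv
  have := intervalIntegral.integral_comp_sub_left (fun s => b s • a (t - s)) (a := 0) (b := t) t
  simp only [sub_self, sub_zero, sub_sub_cancel] at this
  rw [← this]
  refine intervalIntegral.integral_congr fun s _ => ?_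
  simp [mul_comm]

lemma conv_one (h : ℝ → E) (t : ℝ) : conv (fun _ => 1) h t = ∫ s in (0 : ℝ)..t, h s := by
  unfold conv
  have := intervalIntegral.integral_comp_sub_left (fun s => h s) (a := 0) (b := t) t
  simp only [sub_self, sub_zero] at this
  simp [this]

lemma intervalIntegrable_conv_integrand {T t : ℝ} {a : ℝ → ℝ} {h : ℝ → E}
    (ha : IntervalIntegrable a volume 0 T) (hh : ContinuousOn h (Icc 0 T)) (ht : t ∈ Icc 0 T) :
    IntervalIntegrable (fun s => a s • h (t - s)) volume 0 t := by
  have h1 : IntervalIntegrable a volume 0 t := by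
    refine ha.mono_set ?_
    rw [uIcc_of_le ht.1, uIcc_of_le (ht.1.trans ht.2)]
    exact Icc_subset_Icc_right ht.2
  refine h1.smul_continuousOn ?_
  rw [uIcc_of_le ht.1]
  refine hh.comp (by fun_prop) fun s hs => ⟨by linarith [hs.2], by linarith [hs.1, ht.2]⟩

lemma conv_add {T t : ℝ} {a : ℝ → ℝ} {h k : ℝ → E}
    (ha : IntervalIntegrable a volume 0 T) (hh : ContinuousOn h (Icc 0 T))
    (hk : ContinuousOn k (Icc 0 T)) (ht : t ∈ Icc 0 T) :
    conv a (fun s => h s + k s) t = conv a h t + conv a k t := by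
  unfold conv
  rw [← intervalIntegral.integral_add (intervalIntegrable_conv_integrand ha hh ht)
    (intervalIntegrable_conv_integrand ha hk ht)]
  simp only [smul_add]

lemma conv_smul {𝕜 : Type*} [NormedField 𝕜] [NormedSpace 𝕜 E] [SMulCommClass ℝ 𝕜 E]
    (c : 𝕜) (a : ℝ → ℝ) (h : ℝ → E) (t : ℝ) :
    conv a (fun s => c • h s) t = c • conv a h t := by
  unfold conv
  rw [← intervalIntegral.integral_smul]
  simp only [smul_comm]

lemma conv_sub {T t : ℝ} {a : ℝ → ℝ} {h k : ℝ → E}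
    (ha : IntervalIntegrable a volume 0 T) (hh : ContinuousOn h (Icc 0 T))
    (hk : ContinuousOn k (Icc 0 T)) (ht : t ∈ Icc 0 T) :
    conv a (fun s => h s - k s) t = conv a h t - conv a k t := by
  unfold conv
  rw [← intervalIntegral.integral_sub (intervalIntegrable_conv_integrand ha hh ht)
    (intervalIntegrable_conv_integrand ha hk ht)]
  simp only [smul_sub]

lemma add_conv {T t : ℝ} {a b : ℝ → ℝ} {h : ℝ → E}
    (ha : IntervalIntegrable a volume 0 T) (hb : IntervalIntegrable b volume 0 T)
    (hh : ContinuousOn h (Icc 0 T)) (ht : t ∈ Icc 0 T) :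
    conv (fun s => a s + b s) h t = conv a h t + conv b h t := by
  unfold conv
  rw [← intervalIntegral.integral_add (intervalIntegrable_conv_integrand ha hh ht)
    (intervalIntegrable_conv_integrand hb hh ht)]
  simp only [add_smul]

lemma smul_conv (c : ℝ) (a : ℝ → ℝ) (h : ℝ → E) (t : ℝ) :
    conv (fun s => c * a s) h t = c • conv a h t := by
  unfold conv
  rw [← intervalIntegral.integral_smul]
  simp only [mul_smul]

/-- For functions vanishing on `(-∞, 0]` the one-sided convolution is the convolution on `ℝ`. -/
lemma conv_eq_convolution {a : ℝ → ℝ} {h : ℝ → E} (ha : ∀ s ≤ 0, a s = 0)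
    (hh : ∀ s ≤ 0, h s = 0) {t : ℝ} (ht : 0 ≤ t) :
    convolution a h (ContinuousLinearMap.lsmul ℝ ℝ) volume t = conv a h t := by
  rw [convolution_lsmul, conv, intervalIntegral.integral_of_le ht]
  symm
  refine setIntegral_eq_integral_of_forall_compl_eq_zero fun s hs => ?_
  rcases le_or_gt s 0 with h0 | h0
  · rw [ha s h0, zero_smul]
  · have : t < s := by
      by_contra hc
      exact hs ⟨h0, not_lt.mp hc⟩
    rw [hh (t - s) (by linarith), smul_zero]

lemma convolution_eq_zero_of_nonpos {a : ℝ → ℝ} {h : ℝ → E} (ha : ∀ s ≤ 0, a s = 0)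
    (hh : ∀ s ≤ 0, h s = 0) {t : ℝ} (ht : t ≤ 0) :
    convolution a h (ContinuousLinearMap.lsmul ℝ ℝ) volume t = 0 := by
  rw [convolution_lsmul]
  refine integral_eq_zero_of_ae (Eventually.of_forall fun s => ?_)
  rcases le_or_gt s 0 with h0 | h0
  · simp [ha s h0]
  · simp [hh (t - s) (by linarith)]

/-- Associativity of the one-sided convolution. Two factors need only be integrable; the third
is bounded, which makes the triple integral converge absolutely at every `t`. -/
lemma conv_conv [CompleteSpace E] {T t : ℝ} {a b : ℝ → ℝ} {h : ℝ → E}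
    (ha : IntervalIntegrable a volume 0 T) (hb : IntervalIntegrable b volume 0 T)
    (hh : ContinuousOn h (Icc 0 T)) (ht : t ∈ Icc 0 T) :
    conv a (conv b h) t = conv (conv a b) h t := by
  have hT : 0 ≤ T := ht.1.trans ht.2
  set a' := (Ioo 0 T).indicator a with ha'
  set b' := (Ioo 0 T).indicator b with hb'
  set h' := (Ioo 0 T).indicator h with hh'
  have int_of : ∀ {c : ℝ → ℝ}, IntervalIntegrable c volume 0 T →
      Integrable ((Ioo 0 T).indicator c) := fun {c} hc => by
    rw [integrable_indicator_iff measurableSet_Ioo]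
    exact ((intervalIntegrable_iff_integrableOn_Ioc_of_le hT).mp hc).mono_set Ioo_subset_Ioc_self
  have ia : Integrable a' := int_of ha
  have ib : Integrable b' := int_of hb
  have ih : Integrable h' := by
    rw [integrable_indicator_iff measurableSet_Ioo]
    exact (hh.integrableOn_compact isCompact_Icc).mono_set Ioo_subset_Icc_self
  obtain ⟨M, hM⟩ := isCompact_Icc.exists_bound_of_continuousOn hh
  have hM0 : 0 ≤ M := (norm_nonneg _).trans (hM 0 ⟨le_rfl, hT⟩)
  have bh : ∀ s, ‖h' s‖ ≤ M := fun s => by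
    by_cases hs : s ∈ Ioo 0 T
    · rw [hh', indicator_of_mem hs]
      exact hM s (Ioo_subset_Icc_self hs)
    · rw [hh', indicator_of_notMem hs, norm_zero]
      exact hM0
  have za : ∀ s ≤ 0, a' s = 0 := fun s hs => indicator_of_notMem (fun h => absurd h.1 hs.not_gt) _
  have zb : ∀ s ≤ 0, b' s = 0 := fun s hs => indicator_of_notMem (fun h => absurd h.1 hs.not_gt) _
  have zh : ∀ s ≤ 0, h' s = 0 := fun s hs => indicator_of_notMem (fun h => absurd h.1 hs.not_gt) _
  have ea : ∀ s ∈ Ioo 0 t, a s = a' s := fun s hs =>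
    (indicator_of_mem (show s ∈ Ioo 0 T from ⟨hs.1, hs.2.trans_le ht.2⟩) a).symm
  have eb : ∀ s ∈ Ioo 0 t, b s = b' s := fun s hs =>
    (indicator_of_mem (show s ∈ Ioo 0 T from ⟨hs.1, hs.2.trans_le ht.2⟩) b).symm
  have eh : ∀ s ∈ Ioo 0 t, h s = h' s := fun s hs =>
    (indicator_of_mem (show s ∈ Ioo 0 T from ⟨hs.1, hs.2.trans_le ht.2⟩) h).symm
  have key := convolution_assoc (𝕜 := ℝ) (μ := volume) (ν := volume) (f := a') (g := b') (k := h')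
    (ContinuousLinearMap.lsmul ℝ ℝ) (ContinuousLinearMap.lsmul ℝ ℝ)
    (ContinuousLinearMap.lsmul ℝ ℝ) (ContinuousLinearMap.lsmul ℝ ℝ)
    (fun x y z => mul_smul x y z) (x₀ := t)
    ia.aestronglyMeasurable ib.aestronglyMeasurable ih.aestronglyMeasurable
    (ia.ae_convolution_exists _ ib)
    (ib.norm.ae_convolution_exists _ ih.norm)
    (by
      have hG : Integrable (convolution (fun x => ‖b' x‖) (fun x => ‖h' x‖)
        (ContinuousLinearMap.mul ℝ ℝ) volume) := ib.norm.integrable_convolution _ ih.norm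
      refine ia.norm.mul_bdd (c := (∫ x, ‖b' x‖) * M) (hG.comp_sub_left t).aestronglyMeasurable
        (Eventually.of_forall fun s => ?_)
      rw [convolution_mul, ← integral_mul_const, Real.norm_of_nonneg
        (integral_nonneg fun x => by positivity)]
      refine integral_mono_of_nonneg (Eventually.of_forall fun x => by positivity)
        (ib.norm.mul_const _) (Eventually.of_forall fun x => ?_)
      exact mul_le_mul_of_nonneg_left (bh _) (norm_nonneg _))
  have h1 : conv a (conv b h) t = conv a' (convolution b' h' (ContinuousLinearMap.lsmul ℝ ℝ)
      volume) t := by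
    refine conv_congr ht.1 ea fun s hs => ?_
    rw [conv_eq_convolution zb zh hs.1.le]
    exact conv_congr hs.1.le (fun r hr => eb r ⟨hr.1, hr.2.trans hs.2⟩)
      fun r hr => eh r ⟨hr.1, hr.2.trans hs.2⟩
  have h2 : conv (conv a b) h t = conv (convolution a' b' (ContinuousLinearMap.lsmul ℝ ℝ)
      volume) h' t := by
    refine conv_congr ht.1 (fun s hs => ?_) eh
    rw [conv_eq_convolution za zb hs.1.le]
    exact conv_congr hs.1.le (fun r hr => ea r ⟨hr.1, hr.2.trans hs.2⟩)
      fun r hr => eb r ⟨hr.1, hr.2.trans hs.2⟩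
  rw [h1, h2, ← conv_eq_convolution za (fun s hs => convolution_eq_zero_of_nonpos zb zh hs) ht.1,
    ← conv_eq_convolution (fun s hs => convolution_eq_zero_of_nonpos za zb hs) zh ht.1, key]

lemma continuousOn_conv {T : ℝ} (hT : 0 ≤ T) {a : ℝ → ℝ} {h : ℝ → E}
    (ha : IntervalIntegrable a volume 0 T) (hh : ContinuousOn h (Icc 0 T)) :
    ContinuousOn (conv a h) (Icc 0 T) := by
  set H : ℝ → E := IccExtend hT ((Icc 0 T).domRestrict h) with hH
  have cH : Continuous H := hh.domRestrict.Icc_extend'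
  have eH : ∀ s ∈ Icc 0 T, H s = h s := fun s hs => IccExtend_of_mem hT _ hs
  obtain ⟨M, hM⟩ := isCompact_Icc.exists_bound_of_continuousOn hh
  have bH : ∀ s, ‖H s‖ ≤ M := fun s => hM _ (projIcc 0 T hT s).2
  have hM0 : 0 ≤ M := (norm_nonneg _).trans (bH 0)
  -- On a fixed interval the moving endpoint becomes an indicator, continuous in `t` off `s = t`.
  have key : ∀ t ∈ Icc 0 T, conv a h t =
      ∫ s in (0 : ℝ)..T, (Iio t).indicator (fun s => a s • H (t - s)) s := fun t ht => by
    rw [conv, intervalIntegral.integral_of_le ht.1, intervalIntegral.integral_of_le hT,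
      setIntegral_indicator measurableSet_Iio, integral_Ioc_eq_integral_Ioo]
    have : Ioc 0 T ∩ Iio t = Ioo 0 t := by
      ext s
      simp only [mem_inter_iff, mem_Ioc, mem_Iio, mem_Ioo]
      exact ⟨fun h => ⟨h.1.1, h.2⟩, fun h => ⟨⟨h.1, h.2.le.trans ht.2⟩, h.2⟩⟩
    rw [this]
    refine setIntegral_congr_fun measurableSet_Ioo fun s hs => ?_
    rw [eH _ ⟨by linarith [hs.2], by linarith [hs.1, ht.2]⟩]
  refine ContinuousOn.congr (f := fun t => ∫ s in (0 : ℝ)..T,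
    (Iio t).indicator (fun s => a s • H (t - s)) s) (fun t₀ ht₀ => ?_) key
  have hm : AEStronglyMeasurable a (volume.restrict (uIoc 0 T)) := by
    rw [uIoc_of_le hT]
    exact ha.1.aestronglyMeasurable
  refine intervalIntegral.continuousWithinAt_of_dominated_interval (bound := fun s => ‖a s‖ * M)
    (Eventually.of_forall fun t => ?_) (Eventually.of_forall fun t => ?_)
    (ha.norm.mul_const M) ?_
  · refine AEStronglyMeasurable.indicator ?_ measurableSet_Iio
    exact hm.smul (by fun_prop : Continuous fun s => H (t - s)).aestronglyMeasurable
  · refine Eventually.of_forall fun s _ => ?_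
    refine (norm_indicator_le_norm_self _ _).trans ?_
    rw [norm_smul]
    exact mul_le_mul_of_nonneg_left (bH _) (norm_nonneg _)
  · filter_upwards [compl_mem_ae_iff.mpr (measure_singleton t₀)] with s hs _
    have hs : s ≠ t₀ := hs
    refine ContinuousAt.continuousWithinAt ?_
    have c1 : ContinuousAt (fun t => a s • H (t - s)) t₀ := by fun_prop
    rcases lt_or_gt_of_ne hs with h1 | h1
    · refine c1.congr ?_
      filter_upwards [lt_mem_nhds h1] with t ht
      rw [indicator_of_mem (show s ∈ Iio t from ht)]
    · refine (continuousAt_const (y := (0 : E))).congr ?_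
      filter_upwards [gt_mem_nhds h1] with t ht
      rw [indicator_of_notMem (show s ∉ Iio t from fun h => absurd h (not_lt.mpr (le_of_lt ht)))]

lemma hasDerivWithinAt_integral_Icc [CompleteSpace E] {T t : ℝ} {z : ℝ → E}
    (hi : IntervalIntegrable z volume 0 t) (ht : t ∈ Icc 0 T)
    (hm : StronglyMeasurableAtFilter z (𝓝[Icc 0 T] t))
    (hz : ContinuousWithinAt z (Icc 0 T) t) :
    HasDerivWithinAt (fun x => ∫ s in (0 : ℝ)..x, z s) (z t) (Icc 0 T) t := by
  have : Fact (t ∈ Icc 0 T) := ⟨ht⟩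
  exact intervalIntegral.integral_hasDerivWithinAt_right hi hm hz

/-- A continuous function is determined by its primitive. -/
lemma eqOn_of_conv_one_eq [CompleteSpace E] {T : ℝ} (hT : 0 < T) {z w : ℝ → E}
    (hz : ContinuousOn z (Icc 0 T)) (hw : ContinuousOn w (Icc 0 T))
    (h : ∀ t ∈ Icc 0 T, conv (fun _ => 1) z t = conv (fun _ => 1) w t) :
    EqOn z w (Icc 0 T) := by
  intro t ht
  have d : ∀ {y : ℝ → E}, ContinuousOn y (Icc 0 T) →
      HasDerivWithinAt (conv (fun _ => 1) y) (y t) (Icc 0 T) t := fun {y} hy => by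
    have h1 := hasDerivWithinAt_integral_Icc (T := T) (t := t) (z := y)
      ((hy.mono (by rw [uIcc_of_le ht.1]; exact Icc_subset_Icc_right ht.2)).intervalIntegrable) ht
      (hy.stronglyMeasurableAtFilter_nhdsWithin measurableSet_Icc t) (hy t ht)
    exact h1.congr (fun x _ => conv_one y x) (conv_one y t)
  exact (uniqueDiffOn_Icc hT t ht).eq_deriv _ (d hz)
    ((d hw).congr (fun x hx => h x hx) (h t ht))

end Conv

/-! ### Fractional kernels and Mittag-Leffler series -/

section Kernels

/-- The kernel `k_μ(t) = t^(μ - 1) / Γ(μ)` of the fractional integral of order `μ`. -/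
def fracKernel (μ t : ℝ) : ℝ :=
  t ^ (μ - 1) / Real.Gamma μ

lemma fracKernel_one (t : ℝ) : fracKernel 1 t = 1 := by
  simp [fracKernel]

lemma fracKernel_pos {μ t : ℝ} (hμ : 0 < μ) (ht : 0 < t) : 0 < fracKernel μ t :=
  div_pos (Real.rpow_pos_of_pos ht _) (Real.Gamma_pos_of_pos hμ)

lemma mul_fracKernel {μ t : ℝ} (hμ : 0 < μ) (ht : 0 < t) :
    t * fracKernel μ t = μ * fracKernel (μ + 1) t := by
  unfold fracKernel
  have h1 := (Real.Gamma_pos_of_pos hμ).ne'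
  rw [Real.Gamma_add_one hμ.ne', add_sub_cancel_right, Real.rpow_sub_one ht.ne']
  field_simp

lemma intervalIntegrable_fracKernel {μ : ℝ} (hμ : 0 < μ) (a b : ℝ) :
    IntervalIntegrable (fracKernel μ) volume a b :=
  (intervalIntegral.intervalIntegrable_rpow' (by linarith)).div_const _

lemma fracIntegral_eq_conv {H : Type*} [NormedAddCommGroup H] [NormedSpace ℝ H] (μ : ℝ)
    (h : ℝ → H) (t : ℝ) : fracIntegral μ h t = conv (fracKernel μ) h t := by
  unfold fracIntegral conv
  have := intervalIntegral.integral_comp_sub_left (fun s => s ^ (μ - 1) • h (t - s))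
    (a := 0) (b := t) t
  simp only [sub_self, sub_zero, sub_sub_cancel] at this
  rw [this, ← intervalIntegral.integral_smul]
  refine intervalIntegral.integral_congr fun s _ => ?_
  simp only [fracKernel, div_eq_inv_mul, mul_smul]

lemma integral_rpow_mul_rpow_sub {μ ν t : ℝ} (hμ : 0 < μ) (hν : 0 < ν) (ht : 0 < t) :
    ∫ s in (0 : ℝ)..t, s ^ (μ - 1) * (t - s) ^ (ν - 1) =
      t ^ (μ + ν - 1) * (Real.Gamma μ * Real.Gamma ν / Real.Gamma (μ + ν)) := by
  have h1 := Complex.betaIntegral_scaled (μ : ℂ) (ν : ℂ) ht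
  have h2 := Complex.betaIntegral_eq_Gamma_mul_div (μ : ℂ) (ν : ℂ) (by simpa) (by simpa)
  rw [h2] at h1
  apply Complex.ofReal_injective
  rw [← intervalIntegral.integral_ofReal]
  have h3 : ∫ s in (0 : ℝ)..t, ((s ^ (μ - 1) * (t - s) ^ (ν - 1) : ℝ) : ℂ) =
      ∫ s in (0 : ℝ)..t, (s : ℂ) ^ ((μ : ℂ) - 1) * ((t : ℂ) - s) ^ ((ν : ℂ) - 1) := by
    refine intervalIntegral.integral_congr fun s hs => ?_
    rw [uIcc_of_le ht.le] at hs
    rw [Complex.ofReal_mul, Complex.ofReal_cpow hs.1, Complex.ofReal_cpow (sub_nonneg.mpr hs.2)]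
    push_cast
    rfl
  rw [h3, h1, ← Complex.ofReal_add, Complex.Gamma_ofReal, Complex.Gamma_ofReal,
    Complex.Gamma_ofReal, Complex.ofReal_mul, Complex.ofReal_cpow ht.le]
  push_cast
  rfl

/-- The semigroup law of the fractional kernels: the Beta integral. -/
lemma conv_fracKernel {μ ν t : ℝ} (hμ : 0 < μ) (hν : 0 < ν) (ht : 0 < t) :
    conv (fracKernel μ) (fracKernel ν) t = fracKernel (μ + ν) t := by
  have h1 := (Real.Gamma_pos_of_pos hμ).ne'
  have h2 := (Real.Gamma_pos_of_pos hν).ne'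
  have h3 : conv (fracKernel μ) (fracKernel ν) t = (Real.Gamma μ * Real.Gamma ν)⁻¹ *
      ∫ s in (0 : ℝ)..t, s ^ (μ - 1) * (t - s) ^ (ν - 1) := by
    rw [← intervalIntegral.integral_const_mul]
    refine intervalIntegral.integral_congr fun s _ => ?_
    simp only [fracKernel, smul_eq_mul]
    field_simp
  rw [h3, integral_rpow_mul_rpow_sub hμ hν ht, fracKernel]
  field_simp

lemma intervalIntegrable_fracKernel_mul {μ ν t : ℝ} (hμ : 0 < μ) (hν : 0 < ν) (ht : 0 < t) :
    IntervalIntegrable (fun s => fracKernel μ s * fracKernel ν (t - s)) volume 0 t := by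
  refine intervalIntegral.intervalIntegrable_of_integral_ne_zero ?_
  have := conv_fracKernel hμ hν ht
  simp only [conv, smul_eq_mul] at this
  rw [this]
  exact (fracKernel_pos (by positivity) ht).ne'

/-- `Γ` grows faster than every exponential. -/
lemma rpow_mul_exp_le_Gamma {x R : ℝ} (hx : 1 ≤ x) (hR : 0 < R) :
    R ^ (x - 1) * Real.exp (-R) ≤ Real.Gamma x := by
  have hx0 : 0 < x := by linarith
  rw [Real.Gamma_eq_integral hx0, ← integral_exp_neg_Ioi, ← integral_const_mul]
  have hi := Real.GammaIntegral_convergent hx0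
  calc ∫ t in Ioi R, R ^ (x - 1) * Real.exp (-t)
      ≤ ∫ t in Ioi R, Real.exp (-t) * t ^ (x - 1) := by
        refine setIntegral_mono_on ?_ (hi.mono_set (Ioi_subset_Ioi hR.le)) measurableSet_Ioi
          fun t ht => ?_
        · exact (integrableOn_exp_neg_Ioi R).const_mul _
        · rw [mul_comm]
          exact mul_le_mul_of_nonneg_left
            (Real.rpow_le_rpow hR.le (le_of_lt ht) (by linarith)) (Real.exp_pos _).le
    _ ≤ ∫ t in Ioi 0, Real.exp (-t) * t ^ (x - 1) := by
        refine setIntegral_mono_set hi ?_ (Ioi_subset_Ioi hR.le).eventuallyLE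
        refine (ae_restrict_iff' measurableSet_Ioi).mpr (Eventually.of_forall fun t ht => ?_)
        have : (0 : ℝ) < t := ht
        simp only [Pi.zero_apply]
        positivity

lemma summable_pow_div_Gamma {ρ β : ℝ} (hρ : 0 < ρ) (hβ : 0 < β) (R : ℝ) :
    Summable fun n : ℕ => R ^ n / Real.Gamma (ρ * n + β) := by
  set S : ℝ := 2 * |R| + 1 with hS
  have hS0 : 0 < S := by positivity
  set Q : ℝ := S ^ ρ⁻¹ with hQ
  have hQ0 : 0 < Q := Real.rpow_pos_of_pos hS0 _
  have hQρ : Q ^ ρ = S := by rw [hQ, ← Real.rpow_mul hS0.le, inv_mul_cancel₀ hρ.ne', Real.rpow_one]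
  have hgeo : Summable fun n : ℕ => (Real.exp Q * Q ^ (1 - β)) * (|R| / S) ^ n := by
    refine (summable_geometric_of_lt_one (by positivity) ?_).mul_left _
    rw [div_lt_one hS0, hS]
    linarith [abs_nonneg R]
  refine Summable.of_norm_bounded_eventually_nat hgeo ?_
  obtain ⟨N, hN⟩ := exists_nat_ge (1 / ρ)
  filter_upwards [Ici_mem_atTop N] with n hn
  have hn' : (N : ℝ) ≤ n := by exact_mod_cast hn
  have h1 : 1 ≤ ρ * n := by
    rw [div_le_iff₀ hρ] at hN
    nlinarith
  have hΓ := rpow_mul_exp_le_Gamma (x := ρ * n + β) (by linarith) hQ0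
  have hΓ0 : 0 < Real.Gamma (ρ * n + β) := Real.Gamma_pos_of_pos (by linarith)
  have h2 : Q ^ (ρ * n + β - 1) = S ^ n * (Q ^ (1 - β))⁻¹ := by
    rw [← Real.rpow_neg hQ0.le, ← hQρ, ← Real.rpow_natCast, ← Real.rpow_mul hQ0.le,
      ← Real.rpow_add hQ0]
    congr 1
    ring
  rw [norm_div, norm_pow, Real.norm_eq_abs, Real.norm_of_nonneg hΓ0.le, div_le_iff₀ hΓ0]
  refine le_trans ?_ (mul_le_mul_of_nonneg_left hΓ (by positivity))
  rw [h2, div_pow, Real.exp_neg]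
  have : Q ^ (1 - β) ≠ 0 := (Real.rpow_pos_of_pos hQ0 _).ne'
  apply le_of_eq
  field_simp

lemma continuous_mittagLeffler {ρ β : ℝ} (hρ : 0 < ρ) (hβ : 0 < β) :
    Continuous (mittagLeffler ρ β) := by
  rw [continuous_iff_continuousAt]
  intro z
  have : ContinuousOn (mittagLeffler ρ β) (Metric.ball 0 (|z| + 1)) := by
    refine continuousOn_tsum (u := fun n : ℕ => (|z| + 1) ^ n / Real.Gamma (ρ * n + β))
      (fun n => by fun_prop) (summable_pow_div_Gamma hρ hβ _) fun n x hx => ?_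
    have h0 : 0 < Real.Gamma (ρ * n + β) := Real.Gamma_pos_of_pos (by positivity)
    rw [norm_div, norm_pow, Real.norm_of_nonneg h0.le]
    have : ‖x‖ ≤ |z| + 1 := (mem_ball_zero_iff.mp hx).le
    gcongr
  exact this.continuousAt (Metric.isOpen_ball.mem_nhds (by simp))

lemma mittagLeffler_zero (ρ β : ℝ) : mittagLeffler ρ β 0 = (Real.Gamma β)⁻¹ := by
  unfold mittagLeffler
  rw [tsum_eq_single 0 fun n hn => by simp [hn]]
  simp

/-- The series `∑ cₙ k_{ρ n + β}(t)` in fractional kernels; for `cₙ = (-λ)ⁿ` it is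
`t^(β - 1) E_{ρ,β}(-λ t^ρ)`. -/
def kernelSeries (ρ β : ℝ) (c : ℕ → ℝ) (t : ℝ) : ℝ :=
  ∑' n : ℕ, c n * fracKernel (ρ * n + β) t

lemma fracKernel_nat_mul_add {ρ β t : ℝ} (ht : 0 < t) (n : ℕ) :
    fracKernel (ρ * n + β) t = t ^ (β - 1) * ((t ^ ρ) ^ n / Real.Gamma (ρ * n + β)) := by
  rw [fracKernel, ← Real.rpow_natCast, ← Real.rpow_mul ht.le, mul_div_assoc', ← Real.rpow_add ht]
  congr 2
  ring

lemma summable_kernelSeries {ρ β C R t : ℝ} {c : ℕ → ℝ} (hρ : 0 < ρ) (hβ : 0 < β)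
    (hc : ∀ n, |c n| ≤ C * R ^ n) (ht : 0 < t) :
    Summable fun n : ℕ => |c n| * fracKernel (ρ * n + β) t := by
  refine Summable.of_nonneg_of_le (fun n => ?_) (fun n => ?_)
    ((summable_pow_div_Gamma hρ hβ (R * t ^ ρ)).mul_left (C * t ^ (β - 1)))
  · exact mul_nonneg (abs_nonneg _) (fracKernel_pos (by positivity) ht).le
  · refine (mul_le_mul_of_nonneg_right (hc n) (fracKernel_pos (by positivity) ht).le).trans
      (le_of_eq ?_)
    rw [fracKernel_nat_mul_add ht, mul_pow]
    ring

lemma summable_kernelSeries' {ρ β C R t : ℝ} {c : ℕ → ℝ} (hρ : 0 < ρ) (hβ : 0 < β)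
    (hc : ∀ n, |c n| ≤ C * R ^ n) (ht : 0 < t) :
    Summable fun n : ℕ => c n * fracKernel (ρ * n + β) t := by
  refine Summable.of_norm_bounded (summable_kernelSeries hρ hβ hc ht) fun n => ?_
  rw [norm_mul, Real.norm_eq_abs, Real.norm_of_nonneg (fracKernel_pos (by positivity) ht).le]

/-- Fractional integration of a kernel series shifts its second parameter. -/
lemma conv_kernelSeries {ρ β γ μ C R t : ℝ} {c : ℕ → ℝ} (hρ : 0 < ρ) (hβ : 0 < β) (hμ : 0 < μ)
    (hc : ∀ n, |c n| ≤ C * R ^ n) (ht : 0 < t) (hγ : μ + β = γ) :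
    conv (fracKernel μ) (kernelSeries ρ β c) t = kernelSeries ρ γ c t := by
  have hpos : ∀ n : ℕ, 0 < ρ * n + β := fun n => by positivity
  have hγ' : ∀ n : ℕ, μ + (ρ * n + β) = ρ * n + γ := fun n => by rw [← hγ]; ring
  have hint : ∀ n : ℕ, IntervalIntegrable
      (fun s => c n * (fracKernel μ s * fracKernel (ρ * n + β) (t - s))) volume 0 t :=
    fun n => (intervalIntegrable_fracKernel_mul hμ (hpos n) ht).const_mul _
  have hval : ∀ (d : ℝ) (n : ℕ),
      ∫ s in Ioc 0 t, d * (fracKernel μ s * fracKernel (ρ * n + β) (t - s))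
      = d * fracKernel (ρ * n + γ) t := fun d n => by
    rw [integral_const_mul, ← intervalIntegral.integral_of_le ht.le, ← hγ' n,
      ← conv_fracKernel hμ (hpos n) ht]
    rfl
  have hnorm : ∀ n : ℕ, ∫ s in Ioc 0 t, ‖c n * (fracKernel μ s * fracKernel (ρ * n + β) (t - s))‖
      = |c n| * fracKernel (ρ * n + γ) t := fun n => by
    rw [← hval, integral_Ioc_eq_integral_Ioo, integral_Ioc_eq_integral_Ioo]
    refine setIntegral_congr_fun measurableSet_Ioo fun s hs => ?_
    have h1 := fracKernel_pos hμ hs.1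
    have h2 := fracKernel_pos (hpos n) (sub_pos.mpr hs.2)
    simp only [norm_mul, Real.norm_eq_abs, abs_of_pos h1, abs_of_pos h2]
  have hs := hasSum_integral_of_summable_integral_norm (μ := volume.restrict (Ioc 0 t))
    (F := fun (n : ℕ) s => c n * (fracKernel μ s * fracKernel (ρ * n + β) (t - s)))
    (fun n => (hint n).1) (by
      simp only [hnorm]
      exact summable_kernelSeries hρ (by linarith) hc ht)
  simp only [hval] at hs
  rw [kernelSeries, hs.tsum_eq, conv, intervalIntegral.integral_of_le ht.le]
  refine integral_congr_ae (Eventually.of_forall fun s => ?_)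
  simp only [kernelSeries, smul_eq_mul, ← tsum_mul_left]
  exact tsum_congr fun n => by ring

lemma kernelSeries_pow {ρ β t : ℝ} (lam : ℝ) (ht : 0 < t) :
    kernelSeries ρ β (fun n => (-lam) ^ n) t = t ^ (β - 1) * mittagLeffler ρ β (-lam * t ^ ρ) := by
  rw [kernelSeries, mittagLeffler, ← tsum_mul_left]
  refine tsum_congr fun n => ?_
  rw [fracKernel_nat_mul_add ht, mul_pow]
  ring

lemma abs_neg_pow_le (lam : ℝ) (n : ℕ) : |(-lam) ^ n| ≤ 1 * |lam| ^ n := by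
  rw [abs_pow, abs_neg, one_mul]

/-- The relaxation function `e(t) = E_ρ(-λ t^ρ)`: the solution of `D_t^ρ e + λ e = 0`,
`e(0) = 1`. -/
def relax (ρ lam t : ℝ) : ℝ :=
  mittagLeffler ρ 1 (-lam * t ^ ρ)

/-- The resolvent kernel `g(t) = t^(ρ - 1) E_{ρ,ρ}(-λ t^ρ)` of Duhamel's formula. -/
def relaxKernel (ρ lam t : ℝ) : ℝ :=
  t ^ (ρ - 1) * mittagLeffler ρ ρ (-lam * t ^ ρ)

lemma relax_eq_kernelSeries {ρ t : ℝ} (lam : ℝ) (ht : 0 < t) :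
    relax ρ lam t = kernelSeries ρ 1 (fun n => (-lam) ^ n) t := by
  rw [kernelSeries_pow lam ht, relax]
  simp

lemma relaxKernel_eq_kernelSeries {ρ t : ℝ} (lam : ℝ) (ht : 0 < t) :
    relaxKernel ρ lam t = kernelSeries ρ ρ (fun n => (-lam) ^ n) t := by
  rw [kernelSeries_pow lam ht, relaxKernel]

variable {ρ : ℝ} (lam : ℝ)

lemma relax_zero (hρ : 0 < ρ) : relax ρ lam 0 = 1 := by
  rw [relax, Real.zero_rpow hρ.ne', mul_zero, mittagLeffler_zero, Real.Gamma_one, inv_one]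

lemma continuous_relax (hρ : 0 < ρ) : Continuous (relax ρ lam) :=
  (continuous_mittagLeffler hρ one_pos).comp
    (continuous_const.mul (Real.continuous_rpow_const hρ.le))

lemma intervalIntegrable_relaxKernel (hρ : 0 < ρ) (a b : ℝ) :
    IntervalIntegrable (relaxKernel ρ lam) volume a b := by
  refine (intervalIntegral.intervalIntegrable_rpow' (by linarith)).mul_continuousOn ?_
  exact ((continuous_mittagLeffler hρ hρ).comp
    (continuous_const.mul (Real.continuous_rpow_const hρ.le))).continuousOn

lemma conv_fracKernel_relaxKernel (hρ : ρ ∈ Ioo (0 : ℝ) 1) {t : ℝ} (ht : 0 < t) :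
    conv (fracKernel (1 - ρ)) (relaxKernel ρ lam) t = relax ρ lam t := by
  rw [relax_eq_kernelSeries lam ht,
    ← conv_kernelSeries hρ.1 hρ.1 (sub_pos.mpr hρ.2) (abs_neg_pow_le lam) ht (sub_add_cancel 1 ρ)]
  exact conv_congr ht.le (fun _ _ => rfl) fun s hs => relaxKernel_eq_kernelSeries lam hs.1

lemma relax_eq_one_sub (hρ : 0 < ρ) {t : ℝ} (ht : 0 < t) :
    relax ρ lam t = 1 - lam * kernelSeries ρ (ρ + 1) (fun n => (-lam) ^ n) t := by
  have hs := summable_kernelSeries' hρ one_pos (abs_neg_pow_le lam) ht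
  rw [relax_eq_kernelSeries lam ht, kernelSeries, hs.tsum_eq_zero_add, kernelSeries,
    sub_eq_add_neg, ← neg_mul, ← tsum_mul_left]
  congr 1
  · simp [fracKernel_one]
  · refine tsum_congr fun n => ?_
    rw [pow_succ', mul_assoc]
    congr 3
    push_cast
    ring

lemma conv_one_relaxKernel (hρ : 0 < ρ) {t : ℝ} (ht : 0 < t) :
    lam * conv (fun _ => 1) (relaxKernel ρ lam) t = 1 - relax ρ lam t := by
  rw [relax_eq_one_sub lam hρ ht, sub_sub_cancel,
    ← conv_kernelSeries hρ hρ one_pos (abs_neg_pow_le lam) ht (add_comm 1 ρ)]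
  congr 1
  exact conv_congr ht.le (fun s _ => (fracKernel_one s).symm)
    fun s hs => relaxKernel_eq_kernelSeries lam hs.1

/-- The integrated form of `D_t^ρ e = -λ e`. -/
lemma conv_fracKernel_relax_sub_one (hρ : ρ ∈ Ioo (0 : ℝ) 1) {t : ℝ} (ht : 0 < t) :
    conv (fracKernel (1 - ρ)) (fun s => relax ρ lam s - 1) t =
      -lam * conv (fun _ => 1) (relax ρ lam) t := by
  have hρ1 : 0 < ρ + 1 := by linarith [hρ.1]
  have h1 : conv (fracKernel (1 - ρ)) (fun s => relax ρ lam s - 1) t =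
      conv (fracKernel (1 - ρ))
        (fun s => (-lam) • kernelSeries ρ (ρ + 1) (fun n => (-lam) ^ n) s) t := by
    refine conv_congr ht.le (fun _ _ => rfl) fun s hs => ?_
    rw [relax_eq_one_sub lam hρ.1 hs.1, smul_eq_mul]
    ring
  have h2 : conv (fun _ => 1) (relax ρ lam) t =
      conv (fracKernel 1) (kernelSeries ρ 1 (fun n => (-lam) ^ n)) t :=
    conv_congr ht.le (fun s _ => (fracKernel_one s).symm)
      fun s hs => relax_eq_kernelSeries lam hs.1
  rw [h1, h2, conv_smul, smul_eq_mul,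
    conv_kernelSeries hρ.1 one_pos one_pos (abs_neg_pow_le lam) ht (γ := 2) (by norm_num),
    conv_kernelSeries hρ.1 hρ1 (sub_pos.mpr hρ.2) (abs_neg_pow_le lam) ht (γ := 2) (by ring)]

lemma mul_relaxKernel_eq_kernelSeries (hρ : 0 < ρ) {t : ℝ} (ht : 0 < t) :
    t * relaxKernel ρ lam t =
      kernelSeries ρ (ρ + 1) (fun n => ρ * (n + 1) * (-lam) ^ n) t := by
  rw [relaxKernel_eq_kernelSeries lam ht, kernelSeries, kernelSeries, ← tsum_mul_left]
  refine tsum_congr fun n => ?_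
  rw [mul_left_comm, mul_fracKernel (by positivity) ht, ← add_assoc]
  ring

/-- The integrated form of `D_t^ρ (t g) + λ t g = ρ e`, which leads to `t g = ρ (g * e)`. -/
lemma conv_mul_relaxKernel (hρ : ρ ∈ Ioo (0 : ℝ) 1) {t : ℝ} (ht : 0 < t) :
    conv (fracKernel (1 - ρ)) (fun s => s * relaxKernel ρ lam s) t +
      lam * conv (fun _ => 1) (fun s => s * relaxKernel ρ lam s) t =
      ρ * conv (fun _ => 1) (relax ρ lam) t := by
  have hρ0 := hρ.1
  have hρ1 : 0 < ρ + 1 := by linarith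
  set c : ℕ → ℝ := fun n => ρ * (n + 1) * (-lam) ^ n with hc
  have hcb : ∀ n, |c n| ≤ ρ * (2 * |lam|) ^ n := fun n => by
    have h1 : ((n : ℝ) + 1) ≤ 2 ^ n := by exact_mod_cast Nat.lt_two_pow_self (n := n)
    have h0 : (0 : ℝ) ≤ (n : ℝ) + 1 := by positivity
    rw [hc]
    simp only [abs_mul, abs_pow, abs_neg, abs_of_pos hρ0, abs_of_nonneg h0, mul_pow, mul_assoc]
    gcongr
  have h1 : conv (fracKernel (1 - ρ)) (fun s => s * relaxKernel ρ lam s) t =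
      kernelSeries ρ 2 c t := by
    rw [← conv_kernelSeries hρ0 hρ1 (sub_pos.mpr hρ.2) hcb ht (by ring)]
    exact conv_congr ht.le (fun _ _ => rfl) fun s hs => mul_relaxKernel_eq_kernelSeries lam hρ0 hs.1
  have h2 : conv (fun _ => 1) (fun s => s * relaxKernel ρ lam s) t =
      kernelSeries ρ (ρ + 2) c t := by
    rw [← conv_kernelSeries hρ0 hρ1 one_pos hcb ht (by ring)]
    exact conv_congr ht.le (fun s _ => (fracKernel_one s).symm)
      fun s hs => mul_relaxKernel_eq_kernelSeries lam hρ0 hs.1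
  have h3 : conv (fun _ => 1) (relax ρ lam) t = kernelSeries ρ 2 (fun n => (-lam) ^ n) t := by
    rw [← conv_kernelSeries hρ0 one_pos one_pos (abs_neg_pow_le lam) ht (by norm_num)]
    exact conv_congr ht.le (fun s _ => (fracKernel_one s).symm)
      fun s hs => relax_eq_kernelSeries lam hs.1
  have s1 := summable_kernelSeries' hρ0 two_pos hcb ht
  have s2 := summable_kernelSeries' hρ0 (by linarith : 0 < ρ + 2) hcb ht
  have s3 := summable_kernelSeries' hρ0 two_pos (abs_neg_pow_le lam) ht
  rw [h1, h2, h3, kernelSeries, kernelSeries, kernelSeries, s1.tsum_eq_zero_add,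
    s3.tsum_eq_zero_add, add_assoc, mul_add, ← tsum_mul_left, ← tsum_mul_left,
    ← ((summable_nat_add_iff 1).mpr s1).tsum_add (s2.mul_left lam)]
  congr 1
  · simp [hc]
  · refine tsum_congr fun n => ?_
    have : ρ * ((n + 1 : ℕ) : ℝ) + 2 = ρ * n + (ρ + 2) := by push_cast; ring
    rw [this, hc]
    push_cast
    ring

end Kernels

/-! ### The scalar Volterra equation -/

section Resolvent

variable {E : Type*} [NormedAddCommGroup E] [NormedSpace ℝ E] [CompleteSpace E]
  {ρ lam T t : ℝ}

lemma conv_left_comm {a b : ℝ → ℝ} {h : ℝ → E}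
    (ha : IntervalIntegrable a volume 0 T) (hb : IntervalIntegrable b volume 0 T)
    (hh : ContinuousOn h (Icc 0 T)) (ht : t ∈ Icc 0 T) :
    conv a (conv b h) t = conv b (conv a h) t := by
  rw [conv_conv ha hb hh ht, conv_conv hb ha hh ht]
  exact conv_congr ht.1 (fun s _ => conv_comm a b s) fun _ _ => rfl

/-- The kernel `g` inverts `k_{1-ρ} + λ`, up to one integration: the associative law together
with `k_{1-ρ} * g = e` and `λ (1 * g) = 1 - e`. -/
lemma conv_relaxKernel_resolvent (lam : ℝ) (hρ : ρ ∈ Ioo (0 : ℝ) 1) {h : ℝ → E}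
    (hh : ContinuousOn h (Icc 0 T)) (ht : t ∈ Icc 0 T) :
    conv (fracKernel (1 - ρ)) (conv (relaxKernel ρ lam) h) t +
      lam • conv (fun _ => 1) (conv (relaxKernel ρ lam) h) t = conv (fun _ => 1) h t := by
  have ik := intervalIntegrable_fracKernel (sub_pos.mpr hρ.2) 0 T
  have ig := intervalIntegrable_relaxKernel lam hρ.1 0 T
  have i1 : IntervalIntegrable (fun _ : ℝ => (1 : ℝ)) volume 0 T := intervalIntegrable_const
  have ie := (continuous_relax lam hρ.1).intervalIntegrable (μ := volume) 0 T
  rw [conv_conv ik ig hh ht, conv_conv i1 ig hh ht, ← smul_conv]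
  have h1 : conv (conv (fracKernel (1 - ρ)) (relaxKernel ρ lam)) h t = conv (relax ρ lam) h t :=
    conv_congr ht.1 (fun s hs => conv_fracKernel_relaxKernel lam hρ hs.1) fun _ _ => rfl
  have h2 : conv (fun s => lam * conv (fun _ => 1) (relaxKernel ρ lam) s) h t =
      conv (fun s => 1 - relax ρ lam s) h t :=
    conv_congr ht.1 (fun s hs => conv_one_relaxKernel lam hρ.1 hs.1) fun _ _ => rfl
  rw [h1, h2, ← add_conv ie (i1.sub ie) hh ht]
  exact conv_congr ht.1 (fun s _ => by ring) fun _ _ => rfl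

/-- The Volterra equation `k_{1-ρ} * z + λ (1 * z) = 1 * w` has `g * w` as its only continuous
solution. -/
lemma eqOn_conv_relaxKernel (hρ : ρ ∈ Ioo (0 : ℝ) 1) (hT : 0 < T) {z w : ℝ → E}
    (hz : ContinuousOn z (Icc 0 T)) (hw : ContinuousOn w (Icc 0 T))
    (h : ∀ t ∈ Icc 0 T, conv (fracKernel (1 - ρ)) z t + lam • conv (fun _ => 1) z t =
      conv (fun _ => 1) w t) :
    EqOn z (conv (relaxKernel ρ lam) w) (Icc 0 T) := by
  have ik := intervalIntegrable_fracKernel (sub_pos.mpr hρ.2) 0 T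
  have ig := intervalIntegrable_relaxKernel lam hρ.1 0 T
  have i1 : IntervalIntegrable (fun _ : ℝ => (1 : ℝ)) volume 0 T := intervalIntegrable_const
  refine eqOn_of_conv_one_eq hT hz (continuousOn_conv hT.le ig hw) fun t ht => ?_
  rw [conv_left_comm i1 ig hw ht, ← conv_relaxKernel_resolvent lam hρ hz ht,
    conv_left_comm ik ig hz ht, conv_left_comm i1 ig hz ht, ← conv_smul,
    ← conv_add (k := fun s => lam • conv (fun _ => 1) z s) ig (continuousOn_conv hT.le ik hz)
      ((continuousOn_conv hT.le i1 hz).const_smul lam) ht]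
  exact conv_congr ht.1 (fun _ _ => rfl) fun s hs => h s ⟨hs.1.le, hs.2.le.trans ht.2⟩

lemma conv_smul_const (a r : ℝ → ℝ) (x : E) (t : ℝ) :
    conv a (fun s => r s • x) t = conv a r t • x := by
  unfold conv
  rw [← intervalIntegral.integral_smul_const]
  simp only [smul_eq_mul, mul_smul]

/-- Duhamel's formula satisfies the integrated Caputo equation. -/
lemma integrated_equation_of_duhamel (lam : ℝ) (hρ : ρ ∈ Ioo (0 : ℝ) 1) (hT : 0 ≤ T) (c : E)
    {h : ℝ → E} (hh : ContinuousOn h (Icc 0 T)) (ht : t ∈ Icc 0 T) :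
    conv (fracKernel (1 - ρ))
        (fun s => relax ρ lam s • c + conv (relaxKernel ρ lam) h s - c) t +
      lam • conv (fun _ => 1) (fun s => relax ρ lam s • c + conv (relaxKernel ρ lam) h s) t =
      conv (fun _ => 1) h t := by
  rcases ht.1.eq_or_lt with h0 | h0
  · simp [← h0]
  have ik := intervalIntegrable_fracKernel (sub_pos.mpr hρ.2) 0 T
  have ig := intervalIntegrable_relaxKernel lam hρ.1 0 T
  have i1 : IntervalIntegrable (fun _ : ℝ => (1 : ℝ)) volume 0 T := intervalIntegrable_const
  have cg := continuousOn_conv hT ig hh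
  have ce : ContinuousOn (relax ρ lam) (Icc 0 T) := (continuous_relax lam hρ.1).continuousOn
  have e1 : (fun s => relax ρ lam s • c + conv (relaxKernel ρ lam) h s - c) =
      fun s => (relax ρ lam s - 1) • c + conv (relaxKernel ρ lam) h s := by
    funext s
    rw [sub_smul, one_smul]
    abel
  rw [e1, conv_add ik (by fun_prop) cg ht, conv_add i1 (by fun_prop) cg ht, conv_smul_const,
    conv_smul_const, conv_fracKernel_relax_sub_one lam hρ h0,
    ← conv_relaxKernel_resolvent lam hρ hh ht]
  module

/-- A continuous solution of the integrated Caputo equation is given by Duhamel's formula. -/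
lemma eq_duhamel_of_integrated_equation (hρ : ρ ∈ Ioo (0 : ℝ) 1) (hT : 0 < T) {y h : ℝ → E}
    (hy : ContinuousOn y (Icc 0 T)) (hh : ContinuousOn h (Icc 0 T))
    (heq : ∀ t ∈ Icc 0 T, conv (fracKernel (1 - ρ)) (fun s => y s - y 0) t +
      lam • conv (fun _ => 1) y t = conv (fun _ => 1) h t) (ht : t ∈ Icc 0 T) :
    y t = relax ρ lam t • y 0 + conv (relaxKernel ρ lam) h t := by
  have ik := intervalIntegrable_fracKernel (sub_pos.mpr hρ.2) 0 T
  have ig := intervalIntegrable_relaxKernel lam hρ.1 0 T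
  have i1 : IntervalIntegrable (fun _ : ℝ => (1 : ℝ)) volume 0 T := intervalIntegrable_const
  set D : ℝ → E := fun s => relax ρ lam s • y 0 + conv (relaxKernel ρ lam) h s with hD
  have cD : ContinuousOn D (Icc 0 T) :=
    (((continuous_relax lam hρ.1).smul continuous_const).continuousOn).add
      (continuousOn_conv hT.le ig hh)
  have key := eqOn_conv_relaxKernel (lam := lam) (z := fun s => y s - D s) (w := fun _ => 0)
    hρ hT (hy.sub cD) continuousOn_const (fun t ht => by
      have h1 : conv (fracKernel (1 - ρ)) (fun s => y s - D s) t =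
          conv (fracKernel (1 - ρ)) (fun s => y s - y 0) t -
            conv (fracKernel (1 - ρ)) (fun s => D s - y 0) t := by
        rw [← conv_sub (h := fun s => y s - y 0) (k := fun s => D s - y 0) ik
          (hy.sub continuousOn_const) (cD.sub continuousOn_const) ht]
        simp only [sub_sub_sub_cancel_right]
      have h2 := heq t ht
      have h3 := integrated_equation_of_duhamel lam hρ hT.le (y 0) hh ht
      rw [h1, conv_sub i1 hy cD ht]
      have h4 : conv (fun _ => (1 : ℝ)) (fun _ => (0 : E)) t = 0 := by simp [conv]
      rw [h4, smul_sub, sub_add_sub_comm, h2, h3, sub_self])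
  have h5 := key ht
  have h6 : conv (relaxKernel ρ lam) (fun _ => (0 : E)) t = 0 := by simp [conv]
  rw [h6] at h5
  exact sub_eq_zero.mp h5

end Resolvent

/-! ### Sign and bounds of the Mittag-Leffler functions -/

section Bounds

variable {ρ lam t : ℝ}

/-- The identity behind the sign and the decay of `g`. -/
lemma mul_relaxKernel_eq_conv (lam : ℝ) (hρ : ρ ∈ Ioo (0 : ℝ) 1) (ht : 0 < t) :
    t * relaxKernel ρ lam t = ρ * conv (relaxKernel ρ lam) (relax ρ lam) t := by
  have hz : ContinuousOn (fun s => s * relaxKernel ρ lam s) (Icc 0 t) := by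
    have h1 : Continuous fun s : ℝ => s ^ ρ * mittagLeffler ρ ρ (-lam * s ^ ρ) :=
      (Real.continuous_rpow_const hρ.1.le).mul ((continuous_mittagLeffler hρ.1 hρ.1).comp
        (continuous_const.mul (Real.continuous_rpow_const hρ.1.le)))
    refine h1.continuousOn.congr fun s hs => ?_
    rcases hs.1.eq_or_lt with h0 | h0
    · simp [← h0, Real.zero_rpow hρ.1.ne']
    · simp only [relaxKernel]
      rw [← mul_assoc, Real.rpow_sub_one h0.ne', mul_div_cancel₀ _ h0.ne']
  have key := eqOn_conv_relaxKernel (lam := lam) hρ ht hz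
    (w := fun s => ρ • relax ρ lam s)
    ((continuous_relax lam hρ.1).const_smul ρ).continuousOn (fun s hs => by
      rw [conv_smul]
      rcases hs.1.eq_or_lt with h0 | h0
      · simp [← h0]
      · exact conv_mul_relaxKernel lam hρ h0)
  have := key ⟨ht.le, le_rfl⟩
  rw [conv_smul] at this
  exact this

lemma intervalIntegrable_fracKernel_mul_relaxKernel (lam : ℝ) (hρ : ρ ∈ Ioo (0 : ℝ) 1)
    (ht : 0 < t) :
    IntervalIntegrable (fun s => fracKernel (1 - ρ) s • relaxKernel ρ lam (t - s)) volume 0 t := by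
  have h1 := (intervalIntegrable_fracKernel_mul (sub_pos.mpr hρ.2) hρ.1 ht).mul_continuousOn
    (g := fun s => Real.Gamma ρ * mittagLeffler ρ ρ (-lam * (t - s) ^ ρ))
    (continuous_const.mul ((continuous_mittagLeffler hρ.1 hρ.1).comp
      (continuous_const.mul ((Real.continuous_rpow_const hρ.1.le).comp
        (continuous_const.sub continuous_id))))).continuousOn
  refine h1.congr fun s _ => ?_
  have := (Real.Gamma_pos_of_pos hρ.1).ne'
  simp only [relaxKernel, fracKernel, smul_eq_mul]
  field_simp

lemma relax_pos_of_relaxKernel_pos (hρ : ρ ∈ Ioo (0 : ℝ) 1) (ht : 0 < t)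
    (hg : ∀ s ∈ Ioo 0 t, 0 < relaxKernel ρ lam s) : 0 < relax ρ lam t := by
  rw [← conv_fracKernel_relaxKernel lam hρ ht]
  refine intervalIntegral.intervalIntegral_pos_of_pos_on
    (intervalIntegrable_fracKernel_mul_relaxKernel lam hρ ht) (fun s hs => ?_) ht
  exact mul_pos (fracKernel_pos (sub_pos.mpr hρ.2) hs.1)
    (hg _ ⟨by linarith [hs.2], by linarith [hs.1]⟩)

/-- `g > 0`: at a first zero `t₀` the identity `t₀ g(t₀) = ρ ∫₀^{t₀} g(s) e(t₀ - s) ds` would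
have a positive right-hand side, since `e = k_{1-ρ} * g` is positive on `(0, t₀)` as well. -/
lemma relaxKernel_pos (lam : ℝ) (hρ : ρ ∈ Ioo (0 : ℝ) 1) (ht : 0 < t) :
    0 < relaxKernel ρ lam t := by
  set p : ℝ → ℝ := fun s => mittagLeffler ρ ρ (-lam * s ^ ρ) with hp
  have cp : Continuous p := (continuous_mittagLeffler hρ.1 hρ.1).comp
    (continuous_const.mul (Real.continuous_rpow_const hρ.1.le))
  have p0 : 0 < p 0 := by
    simp only [hp]
    rw [Real.zero_rpow hρ.1.ne', mul_zero, mittagLeffler_zero]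
    exact inv_pos.mpr (Real.Gamma_pos_of_pos hρ.1)
  by_contra hneg
  set S : Set ℝ := {s | 0 ≤ s ∧ p s ≤ 0} with hS
  have hSc : IsClosed S := (isClosed_le continuous_const continuous_id).inter
    (isClosed_le cp continuous_const)
  have hSn : S.Nonempty := ⟨t, ht.le, by
    by_contra hc
    exact hneg (mul_pos (Real.rpow_pos_of_pos ht _) (not_le.mp hc))⟩
  have hSb : BddBelow S := ⟨0, fun s hs => hs.1⟩
  obtain ⟨h0, hp0⟩ := hSc.csInf_mem hSn hSb
  set t₀ := sInf S
  have ht₀ : 0 < t₀ := by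
    refine h0.lt_of_ne fun h => ?_
    rw [← h] at hp0
    exact hp0.not_gt p0
  have hg : ∀ s ∈ Ioo 0 t₀, 0 < relaxKernel ρ lam s := fun s hs => by
    refine mul_pos (Real.rpow_pos_of_pos hs.1 _) ?_
    by_contra hc
    exact notMem_of_lt_csInf hs.2 hSb ⟨hs.1.le, not_lt.mp hc⟩
  have hconv : 0 < conv (relaxKernel ρ lam) (relax ρ lam) t₀ := by
    refine intervalIntegral.intervalIntegral_pos_of_pos_on
      (intervalIntegrable_conv_integrand (intervalIntegrable_relaxKernel lam hρ.1 0 t₀)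
        (continuous_relax lam hρ.1).continuousOn ⟨h0, le_rfl⟩) (fun s hs => ?_) ht₀
    refine mul_pos (hg s hs) (relax_pos_of_relaxKernel_pos hρ (sub_pos.mpr hs.2) fun r hr => ?_)
    exact hg r ⟨hr.1, by linarith [hr.2, hs.1]⟩
  have h1 : 0 < t₀ * relaxKernel ρ lam t₀ := by
    rw [mul_relaxKernel_eq_conv lam hρ ht₀]
    exact mul_pos hρ.1 hconv
  have h2 : t₀ * relaxKernel ρ lam t₀ ≤ 0 :=
    mul_nonpos_of_nonneg_of_nonpos h0
      (mul_nonpos_of_nonneg_of_nonpos (Real.rpow_nonneg h0 _) hp0)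
  exact h2.not_gt h1

lemma relax_pos (lam : ℝ) (hρ : ρ ∈ Ioo (0 : ℝ) 1) (ht : 0 ≤ t) : 0 < relax ρ lam t := by
  rcases ht.eq_or_lt with h0 | h0
  · rw [← h0, relax_zero lam hρ.1]
    exact one_pos
  · exact relax_pos_of_relaxKernel_pos hρ h0 fun s hs => relaxKernel_pos lam hρ hs.1

lemma antitoneOn_relax (hρ : ρ ∈ Ioo (0 : ℝ) 1) (hlam : 0 ≤ lam) :
    AntitoneOn (relax ρ lam) (Ici 0) := by
  have key : ∀ s : ℝ, 0 ≤ s →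
      relax ρ lam s = 1 - lam * ∫ r in (0 : ℝ)..s, relaxKernel ρ lam r := fun s hs => by
    rcases hs.eq_or_lt with h0 | h0
    · simp [← h0, relax_zero lam hρ.1]
    · rw [← conv_one, conv_one_relaxKernel lam hρ.1 h0, sub_sub_cancel]
  intro a ha b hb hab
  have ha : (0 : ℝ) ≤ a := ha
  rw [key a ha, key b (ha.trans hab)]
  refine sub_le_sub_left (mul_le_mul_of_nonneg_left ?_ hlam) _
  rw [← intervalIntegral.integral_add_adjacent_intervals
    (intervalIntegrable_relaxKernel lam hρ.1 0 a) (intervalIntegrable_relaxKernel lam hρ.1 a b)]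
  refine le_add_of_nonneg_right (intervalIntegral.integral_nonneg_of_ae_restrict hab ?_)
  rw [← restrict_Ioc_eq_restrict_Icc]
  exact (ae_restrict_iff' measurableSet_Ioc).mpr (Eventually.of_forall fun r hr =>
    (relaxKernel_pos lam hρ (ha.trans_lt hr.1)).le)

lemma relax_le_one (hρ : ρ ∈ Ioo (0 : ℝ) 1) (hlam : 0 ≤ lam) (ht : 0 ≤ t) :
    relax ρ lam t ≤ 1 := by
  rw [← relax_zero lam hρ.1]
  exact antitoneOn_relax hρ hlam (mem_Ici.mpr le_rfl) ht ht

/-- The lower bound `E_ρ(-x) ≥ 1 / (1 + Γ(1 - ρ) x)`: in `λ e(t) = λ (k_{1-ρ} * g)(t)` the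
decreasing kernel is at least `k_{1-ρ}(t)`. -/
lemma inv_relax_le (hρ : ρ ∈ Ioo (0 : ℝ) 1) (hlam : 0 ≤ lam) (ht : 0 < t) :
    (relax ρ lam t)⁻¹ ≤ 1 + Real.Gamma (1 - ρ) * (lam * t ^ ρ) := by
  have hΓ := Real.Gamma_pos_of_pos (sub_pos.mpr hρ.2)
  have hpos := relax_pos lam hρ ht.le
  have htρ : 0 < t ^ ρ := Real.rpow_pos_of_pos ht _
  have hk : fracKernel (1 - ρ) t = (Real.Gamma (1 - ρ) * t ^ ρ)⁻¹ := by
    rw [fracKernel, sub_sub_cancel_left, Real.rpow_neg ht.le, mul_inv, div_eq_inv_mul]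
  have h1 : fracKernel (1 - ρ) t * (1 - relax ρ lam t) ≤ lam * relax ρ lam t := by
    rw [← conv_one_relaxKernel lam hρ.1 ht, ← conv_fracKernel_relaxKernel lam hρ ht,
      mul_left_comm]
    refine mul_le_mul_of_nonneg_left ?_ hlam
    unfold conv
    rw [← intervalIntegral.integral_const_mul]
    refine intervalIntegral.integral_mono_on_of_le_Ioo ht.le ?_
      (intervalIntegrable_fracKernel_mul_relaxKernel lam hρ ht) fun s hs => ?_
    · simp only [one_smul]
      refine IntervalIntegrable.const_mul ?_ _
      have := ((intervalIntegrable_relaxKernel lam hρ.1 0 t).comp_sub_left t).symm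
      simpa using this
    · simp only [smul_eq_mul, one_mul]
      refine mul_le_mul_of_nonneg_right ?_ (relaxKernel_pos lam hρ (sub_pos.mpr hs.2)).le
      exact div_le_div_of_nonneg_right
        (Real.rpow_le_rpow_of_nonpos hs.1 hs.2.le (by linarith [hρ.1])) hΓ.le
  rw [hk, inv_mul_le_iff₀ (by positivity)] at h1
  rw [inv_le_iff_one_le_mul₀ hpos]
  linarith

lemma lam_mul_relax_le (hρ : ρ ∈ Ioo (0 : ℝ) 1) (hlam : 0 ≤ lam) (ht : 0 < t) :
    lam * relax ρ lam t ≤ (Real.Gamma (2 - ρ))⁻¹ * t ^ (-ρ) := by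
  have hΓ := Real.Gamma_pos_of_pos (by linarith [hρ.2] : 0 < 2 - ρ)
  have ce := continuous_relax lam hρ.1
  have ik := intervalIntegrable_fracKernel (sub_pos.mpr hρ.2) 0 t
  have h1 : t * relax ρ lam t ≤ conv (fun _ => 1) (relax ρ lam) t := by
    rw [conv_one]
    have : ∫ _ in (0 : ℝ)..t, relax ρ lam t = t * relax ρ lam t := by simp
    rw [← this]
    exact intervalIntegral.integral_mono_on ht.le intervalIntegrable_const
      (ce.intervalIntegrable 0 t) fun s hs =>
        antitoneOn_relax hρ hlam (mem_Ici.mpr hs.1) (mem_Ici.mpr ht.le) hs.2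
  have h2 := conv_fracKernel_relax_sub_one lam hρ ht
  have h3 : conv (fracKernel (1 - ρ)) (fun s => 1 - relax ρ lam s) t ≤ fracKernel (2 - ρ) t := by
    have e1 : (2 : ℝ) - ρ = (1 - ρ) + 1 := by ring
    rw [e1, ← conv_fracKernel (sub_pos.mpr hρ.2) one_pos ht]
    refine intervalIntegral.integral_mono_on_of_le_Ioo ht.le
      (intervalIntegrable_conv_integrand ik
        (continuous_const.sub ce).continuousOn ⟨ht.le, le_rfl⟩)
      (intervalIntegrable_fracKernel_mul (sub_pos.mpr hρ.2) one_pos ht) fun s hs => ?_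
    rw [fracKernel_one]
    exact mul_le_mul_of_nonneg_left
      (by linarith [relax_pos lam hρ (sub_nonneg.mpr hs.2.le)])
      (fracKernel_pos (sub_pos.mpr hρ.2) hs.1).le
  have h4 : conv (fracKernel (1 - ρ)) (fun s => 1 - relax ρ lam s) t =
      lam * conv (fun _ => 1) (relax ρ lam) t := by
    have : (fun s => 1 - relax ρ lam s) = fun s => (-1 : ℝ) • (relax ρ lam s - 1) := by
      funext s
      rw [smul_eq_mul]
      ring
    rw [this, conv_smul, h2, smul_eq_mul]
    ring
  have h5 : fracKernel (2 - ρ) t = t * ((Real.Gamma (2 - ρ))⁻¹ * t ^ (-ρ)) := by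
    rw [fracKernel, div_eq_inv_mul, mul_left_comm]
    congr 1
    nth_rewrite 2 [← Real.rpow_one t]
    rw [← Real.rpow_add ht]
    congr 1
    ring
  have h6 : t * (lam * relax ρ lam t) ≤ t * ((Real.Gamma (2 - ρ))⁻¹ * t ^ (-ρ)) := by
    rw [← h5, mul_left_comm]
    exact (mul_le_mul_of_nonneg_left h1 hlam).trans (h4 ▸ h3)
  exact le_of_mul_le_mul_left h6 ht

lemma lam_mul_mul_relaxKernel_le (hρ : ρ ∈ Ioo (0 : ℝ) 1) (hlam : 0 ≤ lam) (ht : 0 < t) :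
    lam * (t * relaxKernel ρ lam t) ≤ 1 := by
  have h1 : conv (relaxKernel ρ lam) (relax ρ lam) t ≤
      conv (fun _ => 1) (relaxKernel ρ lam) t := by
    rw [conv_comm (fun _ => 1)]
    refine intervalIntegral.integral_mono_on_of_le_Ioo ht.le
      (intervalIntegrable_conv_integrand (intervalIntegrable_relaxKernel lam hρ.1 0 t)
        (continuous_relax lam hρ.1).continuousOn ⟨ht.le, le_rfl⟩)
      (intervalIntegrable_conv_integrand (intervalIntegrable_relaxKernel lam hρ.1 0 t)
        continuousOn_const ⟨ht.le, le_rfl⟩) fun s hs => ?_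
    exact mul_le_mul_of_nonneg_left (relax_le_one hρ hlam (sub_nonneg.mpr hs.2.le))
      (relaxKernel_pos lam hρ hs.1).le
  have h2 := conv_one_relaxKernel lam hρ.1 ht
  have h3 := relax_pos lam hρ ht.le
  have h4 := mul_le_mul_of_nonneg_left h1 hlam
  have h5 := relax_le_one hρ hlam ht.le
  rw [mul_relaxKernel_eq_conv lam hρ ht]
  nlinarith [hρ.1, hρ.2]

/-- The bound on `g` that is uniform in `λ` and trades the factor `λ^(1 - ε)` for the
integrable singularity `t^(ρ ε - 1)`. -/
lemma exists_lam_mul_relaxKernel_le {ε : ℝ} (hρ : ρ ∈ Ioo (0 : ℝ) 1) (hε : ε ∈ Ioo (0 : ℝ) 1) :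
    ∃ C, 0 < C ∧ ∀ lam t : ℝ, 0 < lam → 0 < t →
      lam * relaxKernel ρ lam t ≤ C * t ^ (ρ * ε - 1) * lam ^ ε := by
  obtain ⟨M, hM⟩ := (isCompact_Icc (a := (0 : ℝ)) (b := 1)).exists_bound_of_continuousOn
    (f := fun x => mittagLeffler ρ ρ (-x))
    ((continuous_mittagLeffler hρ.1 hρ.1).comp continuous_neg).continuousOn
  refine ⟨max M 1, by positivity, fun lam t hlam ht => ?_⟩
  have htρ : 0 < t ^ ρ := Real.rpow_pos_of_pos ht _
  set x := lam * t ^ ρ with hx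
  have hx0 : 0 < x := mul_pos hlam htρ
  have key : x ^ (1 - ε) * mittagLeffler ρ ρ (-x) ≤ max M 1 := by
    have hE : 0 < mittagLeffler ρ ρ (-x) := by
      have := relaxKernel_pos x hρ one_pos
      simpa [relaxKernel] using this
    rcases le_total x 1 with h1 | h1
    · have h2 : x ^ (1 - ε) ≤ 1 := Real.rpow_le_one hx0.le h1 (by linarith [hε.2])
      have h3 := (le_abs_self _).trans (hM x ⟨hx0.le, h1⟩)
      exact ((mul_le_of_le_one_left hE.le h2).trans h3).trans (le_max_left _ _)
    · have h2 : x ^ (1 - ε) ≤ x := by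
        nth_rewrite 2 [← Real.rpow_one x]
        exact Real.rpow_le_rpow_of_exponent_le h1 (by linarith [hε.1])
      have h3 := lam_mul_mul_relaxKernel_le hρ hx0.le one_pos
      simp only [relaxKernel, Real.one_rpow, one_mul, mul_one] at h3
      exact ((mul_le_mul_of_nonneg_right h2 hE.le).trans h3).trans (le_max_right _ _)
  have e1 : lam * t ^ (ρ - 1) = t ^ (ρ * ε - 1) * lam ^ ε * x ^ (1 - ε) := by
    rw [hx, Real.mul_rpow hlam.le htρ.le, ← Real.rpow_mul ht.le]
    have a1 : lam = lam ^ ε * lam ^ (1 - ε) := by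
      rw [← Real.rpow_add hlam, add_sub_cancel, Real.rpow_one]
    have a2 : t ^ (ρ - 1) = t ^ (ρ * ε - 1) * t ^ (ρ * (1 - ε)) := by
      rw [← Real.rpow_add ht]
      congr 1
      ring
    rw [a2]
    nth_rewrite 1 [a1]
    ring
  have e2 : lam * relaxKernel ρ lam t =
      t ^ (ρ * ε - 1) * lam ^ ε * (x ^ (1 - ε) * mittagLeffler ρ ρ (-x)) := by
    rw [relaxKernel, ← mul_assoc, e1, hx, neg_mul]
    ring
  rw [e2]
  have h0 : 0 ≤ t ^ (ρ * ε - 1) * lam ^ ε := by positivity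
  calc _ ≤ t ^ (ρ * ε - 1) * lam ^ ε * max M 1 := mul_le_mul_of_nonneg_left key h0
    _ = _ := by ring

end Bounds

/-! ### Caputo derivatives and integrated equations -/

section Caputo

variable {E F : Type*} [NormedAddCommGroup E] [NormedSpace ℝ E] [CompleteSpace E]
  [NormedAddCommGroup F] [NormedSpace ℝ F] [CompleteSpace F] {ρ T : ℝ}

lemma conv_clm (L : E →L[ℝ] F) {a : ℝ → ℝ} {h : ℝ → E} {t : ℝ}
    (ha : IntervalIntegrable a volume 0 T) (hh : ContinuousOn h (Icc 0 T)) (ht : t ∈ Icc 0 T) :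
    conv a (fun s => L (h s)) t = L (conv a h t) := by
  unfold conv
  rw [← L.intervalIntegral_comp_comm (intervalIntegrable_conv_integrand ha hh ht)]
  simp only [map_smul]

lemma HasCaputoDeriv.clm_comp (L : E →L[ℝ] F) (hρ : ρ < 1) {u : ℝ → E} {d : E} {t : ℝ}
    (hu : ContinuousOn u (Icc 0 T)) (ht : t ∈ Icc 0 T) (h : HasCaputoDeriv ρ T u d t) :
    HasCaputoDeriv ρ T (fun s => L (u s)) (L d) t := by
  have key : ∀ s ∈ Icc 0 T, fracIntegral (1 - ρ) (fun s => L (u s) - L (u 0)) s =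
      L (fracIntegral (1 - ρ) (fun s => u s - u 0) s) := fun s hs => by
    rw [fracIntegral_eq_conv, fracIntegral_eq_conv,
      ← conv_clm (h := fun s => u s - u 0) L (intervalIntegrable_fracKernel (sub_pos.mpr hρ) 0 T)
        (hu.sub continuousOn_const) hs]
    simp only [map_sub]
  exact (L.hasFDerivAt.comp_hasDerivWithinAt t h).congr key (key t ht)

lemma HasCaputoDeriv.add {G : Type*} [NormedAddCommGroup G] [NormedSpace ℝ G]
    (hρ : ρ < 1) {u w : ℝ → G} {d e : G} {t : ℝ}
    (hu : ContinuousOn u (Icc 0 T)) (hw : ContinuousOn w (Icc 0 T)) (ht : t ∈ Icc 0 T)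
    (h : HasCaputoDeriv ρ T u d t) (h' : HasCaputoDeriv ρ T w e t) :
    HasCaputoDeriv ρ T (fun s => u s + w s) (d + e) t := by
  have key : ∀ s ∈ Icc 0 T, fracIntegral (1 - ρ) (fun s => u s + w s - (u 0 + w 0)) s =
      fracIntegral (1 - ρ) (fun s => u s - u 0) s +
        fracIntegral (1 - ρ) (fun s => w s - w 0) s := fun s hs => by
    rw [fracIntegral_eq_conv, fracIntegral_eq_conv, fracIntegral_eq_conv,
      ← conv_add (h := fun s => u s - u 0) (k := fun s => w s - w 0)
        (intervalIntegrable_fracKernel (sub_pos.mpr hρ) 0 T)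
        (hu.sub continuousOn_const) (hw.sub continuousOn_const) hs]
    simp only [add_sub_add_comm]
  exact (HasDerivWithinAt.add h h').congr key (key t ht)

/-- The Caputo derivative as an integrated equation. The fractional integral vanishes at `0`
and is continuous there, so nothing is lost at the left endpoint. -/
lemma conv_eq_of_hasCaputoDeriv (hρ : ρ < 1) {u d : ℝ → E} (hu : ContinuousOn u (Icc 0 T))
    (hd : ContinuousOn d (Icc 0 T)) (h : ∀ t ∈ Ioc 0 T, HasCaputoDeriv ρ T u (d t) t)
    {t : ℝ} (ht : t ∈ Icc 0 T) :
    conv (fracKernel (1 - ρ)) (fun s => u s - u 0) t = conv (fun _ => 1) d t := by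
  have ik := intervalIntegrable_fracKernel (sub_pos.mpr hρ) 0 T
  have c1 : ContinuousOn (conv (fracKernel (1 - ρ)) fun s => u s - u 0) (Icc 0 T) :=
    continuousOn_conv (ht.1.trans ht.2) ik (hu.sub continuousOn_const)
  have hder : ∀ s ∈ Ioo 0 t,
      HasDerivAt (conv (fracKernel (1 - ρ)) fun s => u s - u 0) (d s) s := fun s hs => by
    have h1 := (h s ⟨hs.1, hs.2.le.trans ht.2⟩).hasDerivAt
      (Icc_mem_nhds hs.1 (hs.2.trans_le ht.2))
    exact h1.congr_of_eventuallyEq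
      (Eventually.of_forall fun r => (fracIntegral_eq_conv _ _ r).symm)
  rw [conv_one, intervalIntegral.integral_eq_sub_of_hasDerivAt_of_le ht.1
    (c1.mono (Icc_subset_Icc_right ht.2)) hder
    ((hd.mono (by rw [uIcc_of_le ht.1]; exact Icc_subset_Icc_right ht.2)).intervalIntegrable),
    conv_zero_right, sub_zero]

lemma hasCaputoDeriv_of_conv_eq {u d : ℝ → E}
    (hd : ContinuousOn d (Ioc 0 T)) (hi : IntervalIntegrable d volume 0 T)
    (h : ∀ t ∈ Icc 0 T, conv (fracKernel (1 - ρ)) (fun s => u s - u 0) t = conv (fun _ => 1) d t)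
    {t : ℝ} (ht : t ∈ Ioc 0 T) : HasCaputoDeriv ρ T u (d t) t := by
  have ht' : t ∈ Icc 0 T := Ioc_subset_Icc_self ht
  have hT : 0 ≤ T := ht.1.le.trans ht.2
  have hmem : Ioc 0 T ∈ 𝓝[Icc 0 T] t := by
    filter_upwards [self_mem_nhdsWithin, mem_nhdsWithin_of_mem_nhds (Ioi_mem_nhds ht.1)]
      with s hs hs' using ⟨hs', hs.2⟩
  have h1 : HasDerivWithinAt (fun x => ∫ s in (0 : ℝ)..x, d s) (d t) (Icc 0 T) t := by
    refine hasDerivWithinAt_integral_Icc (hi.mono_set ?_) ht' ?_ ?_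
    · rw [uIcc_of_le ht'.1, uIcc_of_le hT]
      exact Icc_subset_Icc_right ht.2
    · exact ⟨Ioc 0 T, hmem, hd.aestronglyMeasurable measurableSet_Ioc⟩
    · exact (hd t ht).mono_of_mem_nhdsWithin hmem
  have h2 : ∀ s ∈ Icc 0 T, fracIntegral (1 - ρ) (fun s => u s - u 0) s =
      ∫ r in (0 : ℝ)..s, d r := fun s hs => by
    rw [fracIntegral_eq_conv, h s hs, conv_one]
  exact h1.congr h2 (h2 t ht')

end Caputo

/-! ### Fourier coefficients and uniform tails -/

section Basis

variable {𝕜 H : Type*} [RCLike 𝕜] [NormedAddCommGroup H] [InnerProductSpace 𝕜 H]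
  (v : HilbertBasis ℕ 𝕜 H)

lemma hasSum_inner_smul (x : H) : HasSum (fun k => inner 𝕜 (v k) x • v k) x := by
  simpa only [HilbertBasis.repr_apply_apply] using v.hasSum_repr x

lemma eq_of_inner_eq {x y : H} (h : ∀ k, inner 𝕜 (v k) x = inner 𝕜 (v k) y) : x = y := by
  refine (hasSum_inner_smul v x).unique ?_
  simp only [h]
  exact hasSum_inner_smul v y

lemma exists_inner_eq {a : ℕ → 𝕜} (ha : Summable fun k => ‖a k‖ ^ 2) :
    ∃ x : H, ∀ k, inner 𝕜 (v k) x = a k := by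
  have hm : Memℓp a 2 := memℓp_gen (by simpa using ha)
  refine ⟨v.repr.symm ⟨a, hm⟩, fun k => ?_⟩
  rw [← HilbertBasis.repr_apply_apply, LinearIsometryEquiv.apply_symm_apply]

lemma hasSum_norm_inner_sq (x : H) : HasSum (fun k => ‖inner 𝕜 (v k) x‖ ^ 2) (‖x‖ ^ 2) := by
  have h := (v.hasSum_inner_mul_inner x x).mapL RCLike.reCLM
  have e1 : RCLike.reCLM (inner 𝕜 x x) = ‖x‖ ^ 2 := by
    rw [RCLike.reCLM_apply, norm_sq_eq_re_inner (𝕜 := 𝕜)]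
  rw [e1] at h
  refine h.congr_fun fun k => ?_
  rw [RCLike.reCLM_apply, inner_mul_symm_re_eq_norm, norm_mul, norm_inner_symm, sq]

lemma norm_le_of_norm_inner_le {x y : H} {B : ℝ} (hB : 0 ≤ B)
    (h : ∀ k, ‖inner 𝕜 (v k) x‖ ≤ B * ‖inner 𝕜 (v k) y‖) : ‖x‖ ≤ B * ‖y‖ := by
  refine le_of_sq_le_sq ?_ (by positivity)
  rw [mul_pow]
  refine hasSum_le (fun k => ?_) (hasSum_norm_inner_sq v x)
    ((hasSum_norm_inner_sq v y).mul_left (B ^ 2))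
  rw [← mul_pow]
  exact pow_le_pow_left₀ (norm_nonneg _) (h k) 2

lemma norm_sum_smul_sq (a : ℕ → 𝕜) (F : Finset ℕ) :
    ‖∑ k ∈ F, a k • v k‖ ^ 2 = ∑ k ∈ F, ‖a k‖ ^ 2 := by
  rw [norm_sq_eq_re_inner (𝕜 := 𝕜), v.orthonormal.inner_sum, map_sum]
  refine Finset.sum_congr rfl fun k _ => ?_
  rw [RCLike.conj_mul, ← RCLike.ofReal_pow, RCLike.ofReal_re]

/-- The tails `∑_{k ≥ N} |p_k(t)|²` tend to zero uniformly in `t ∈ s`. -/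
def UniformSqTail (p : ℕ → ℝ → 𝕜) (s : Set ℝ) : Prop :=
  ∀ δ > 0, ∃ N : ℕ, ∀ F : Finset ℕ, (∀ k ∈ F, N ≤ k) → ∀ t ∈ s, ∑ k ∈ F, ‖p k t‖ ^ 2 ≤ δ

namespace UniformSqTail

variable {p q : ℕ → ℝ → 𝕜} {s : Set ℝ}

lemma of_norm_le (hp : UniformSqTail p s) {B : ℝ} (h : ∀ k, ∀ t ∈ s, ‖q k t‖ ≤ B * ‖p k t‖) :
    UniformSqTail q s := fun δ hδ => by
  obtain ⟨N, hN⟩ := hp (δ / (B ^ 2 + 1)) (by positivity)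
  refine ⟨N, fun F hF t ht => ?_⟩
  calc ∑ k ∈ F, ‖q k t‖ ^ 2 ≤ ∑ k ∈ F, B ^ 2 * ‖p k t‖ ^ 2 :=
        Finset.sum_le_sum fun k _ => by
          rw [← mul_pow]
          exact pow_le_pow_left₀ (norm_nonneg _) (h k t ht) 2
    _ = B ^ 2 * ∑ k ∈ F, ‖p k t‖ ^ 2 := by rw [Finset.mul_sum]
    _ ≤ (B ^ 2 + 1) * (δ / (B ^ 2 + 1)) := by
        refine mul_le_mul (by linarith) (hN F hF t ht) (Finset.sum_nonneg fun _ _ => by positivity)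
          (by positivity)
    _ = δ := by field_simp

lemma add (hp : UniformSqTail p s) (hq : UniformSqTail q s) :
    UniformSqTail (fun k t => p k t + q k t) s := fun δ hδ => by
  obtain ⟨N, hN⟩ := hp (δ / 4) (by positivity)
  obtain ⟨M, hM⟩ := hq (δ / 4) (by positivity)
  refine ⟨max N M, fun F hF t ht => ?_⟩
  have h1 := hN F (fun k hk => (le_max_left _ _).trans (hF k hk)) t ht
  have h2 := hM F (fun k hk => (le_max_right _ _).trans (hF k hk)) t ht
  calc ∑ k ∈ F, ‖p k t + q k t‖ ^ 2 ≤ ∑ k ∈ F, (2 * ‖p k t‖ ^ 2 + 2 * ‖q k t‖ ^ 2) :=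
        Finset.sum_le_sum fun k _ => by
          have := pow_le_pow_left₀ (norm_nonneg _) (norm_add_le (p k t) (q k t)) 2
          nlinarith [sq_nonneg (‖p k t‖ - ‖q k t‖)]
    _ = 2 * ∑ k ∈ F, ‖p k t‖ ^ 2 + 2 * ∑ k ∈ F, ‖q k t‖ ^ 2 := by
        rw [Finset.sum_add_distrib, Finset.mul_sum, Finset.mul_sum]
    _ ≤ δ := by linarith

lemma of_summable {a : ℕ → ℝ} (ha : Summable fun k => a k ^ 2)
    (h : ∀ k, ∀ t ∈ s, ‖p k t‖ ≤ a k) : UniformSqTail p s := fun δ hδ => by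
  have h1 := (summable_iff_vanishing_norm.mp ha) δ hδ
  obtain ⟨S, hS⟩ := h1
  obtain ⟨N, hN⟩ := S.exists_nat_subset_range
  refine ⟨N, fun F hF t ht => ?_⟩
  have hd : Disjoint F S := Finset.disjoint_left.mpr fun k hk hk' =>
    (Finset.mem_range.mp (hN hk')).not_ge (hF k hk)
  refine le_trans (Finset.sum_le_sum fun k _ =>
    pow_le_pow_left₀ (norm_nonneg _) (h k t ht) 2) ?_
  exact (le_abs_self _).trans (hS F hd).le

lemma summable (hp : UniformSqTail p s) {t : ℝ} (ht : t ∈ s) :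
    Summable fun k => ‖p k t‖ ^ 2 := by
  rw [summable_iff_vanishing_norm]
  intro δ hδ
  obtain ⟨N, hN⟩ := hp (δ / 2) (by positivity)
  refine ⟨Finset.range N, fun F hF => ?_⟩
  have h1 := hN F (fun k hk => by
    by_contra hc
    exact Finset.disjoint_left.mp hF hk (Finset.mem_range.mpr (not_le.mp hc))) t ht
  rw [Real.norm_of_nonneg (Finset.sum_nonneg fun _ _ => by positivity)]
  linarith

lemma continuousOn (hp : UniformSqTail p s) (hc : ∀ k, ContinuousOn (p k) s) {P : ℝ → H}
    (hP : ∀ t ∈ s, ∀ k, inner 𝕜 (v k) (P t) = p k t) : ContinuousOn P s := by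
  have hu : TendstoUniformlyOn (fun (n : ℕ) t => ∑ k ∈ Finset.range n, p k t • v k) P atTop s := by
    rw [Metric.tendstoUniformlyOn_iff]
    intro δ hδ
    obtain ⟨N, hN⟩ := hp ((δ / 2) ^ 2) (by positivity)
    filter_upwards [Ici_mem_atTop N] with n hn t ht
    have h1 := hasSum_inner_smul v (P t)
    simp only [hP t ht] at h1
    have h2 : Tendsto (fun m => ‖∑ k ∈ Finset.range m, p k t • v k -
        ∑ k ∈ Finset.range n, p k t • v k‖) atTop
        (𝓝 ‖P t - ∑ k ∈ Finset.range n, p k t • v k‖) :=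
      (h1.tendsto_sum_nat.sub_const _).norm
    rw [dist_eq_norm]
    refine lt_of_le_of_lt (le_of_tendsto h2 ?_) (half_lt_self hδ)
    filter_upwards [Ici_mem_atTop n] with m hm
    rw [← Finset.sum_Ico_eq_sub _ hm]
    refine le_of_sq_le_sq ?_ (by positivity)
    rw [norm_sum_smul_sq]
    exact hN _ (fun k hk => le_trans hn (Finset.mem_Ico.mp hk).1) t ht
  refine hu.continuousOn (Eventually.frequently (Eventually.of_forall fun n => ?_))
  exact continuousOn_finsetSum _ fun k _ => (hc k).smul continuousOn_const

/-- The Fourier coefficients of a continuous function on a compact set: Dini's theorem. -/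
lemma of_continuousOn (hs : IsCompact s) {G : ℝ → H} (hG : ContinuousOn G s) :
    UniformSqTail (fun k t => inner 𝕜 (v k) (G t)) s := fun δ hδ => by
  have hu := Monotone.tendstoUniformlyOn_of_forall_tendsto hs
    (F := fun (n : ℕ) t => ∑ k ∈ Finset.range n, ‖inner 𝕜 (v k) (G t)‖ ^ 2)
    (f := fun t => ‖G t‖ ^ 2)
    (fun n => continuousOn_finsetSum _ fun k _ =>
      ((continuousOn_const.inner hG).norm.pow 2))
    (fun t _ => monotone_nat_of_le_succ fun n => by
      rw [Finset.sum_range_succ]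
      exact le_add_of_nonneg_right (by positivity))
    (hG.norm.pow 2)
    (fun t _ => (hasSum_norm_inner_sq v (G t)).tendsto_sum_nat)
  obtain ⟨N, hN⟩ := ((Metric.tendstoUniformlyOn_iff.mp hu) δ hδ).exists
  refine ⟨N, fun F hF t ht => ?_⟩
  have hd : Disjoint (Finset.range N) F := Finset.disjoint_left.mpr fun k hk hk' =>
    (Finset.mem_range.mp hk).not_ge (hF k hk')
  have h1 := sum_le_hasSum (Finset.range N ∪ F) (fun k _ => by positivity)
    (hasSum_norm_inner_sq v (G t))
  rw [Finset.sum_union hd] at h1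
  have h2 := hN t ht
  rw [Real.dist_eq] at h2
  linarith [le_abs_self (‖G t‖ ^ 2 - ∑ k ∈ Finset.range N, ‖inner 𝕜 (v k) (G t)‖ ^ 2)]

end UniformSqTail

end Basis

/-! ### The graph of the operator -/

section Operator

variable {𝕜 H : Type*} [RCLike 𝕜] [NormedAddCommGroup H] [InnerProductSpace 𝕜 H]
  [CompleteSpace H] {A : H →ₗ.[𝕜] H} {lam : ℕ → ℝ} {v : HilbertBasis ℕ 𝕜 H}

lemma inner_eq_of_mem_graph (hA : IsSelfAdjoint A)
    (hv : ∀ k, (v k, (lam k : 𝕜) • v k) ∈ A.graph) {x y : H} (hxy : (x, y) ∈ A.graph) (k : ℕ) :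
    inner 𝕜 (v k) y = (lam k : 𝕜) * inner 𝕜 (v k) x := by
  obtain ⟨x', hx', hy⟩ := (LinearPMap.mem_graph_iff A).mp hxy
  obtain ⟨w', hw', hw⟩ := (LinearPMap.mem_graph_iff A).mp (hv k)
  have hsym : A.IsFormalAdjoint A := by
    have h1 := LinearPMap.adjoint_isFormalAdjoint hA.dense_domain
    rwa [LinearPMap.isSelfAdjoint_def.mp hA] at h1
  have h2 := hsym w' x'
  simp only at hx' hy hw' hw
  rw [hw, hy, hx', hw', inner_smul_left, RCLike.conj_ofReal] at h2
  exact h2.symm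

/-- Since `A` is closed, membership in its graph can be read off from the Fourier
coefficients. -/
lemma mem_graph_of_inner_eq (hA : IsSelfAdjoint A)
    (hv : ∀ k, (v k, (lam k : 𝕜) • v k) ∈ A.graph) {x y : H}
    (h : ∀ k, inner 𝕜 (v k) y = (lam k : 𝕜) * inner 𝕜 (v k) x) : (x, y) ∈ A.graph := by
  have h1 := (hasSum_inner_smul v x).tendsto_sum_nat.prodMk_nhds
    (hasSum_inner_smul v y).tendsto_sum_nat
  refine IsClosed.mem_of_tendsto (show IsClosed (A.graph : Set (H × H)) from hA.isClosed) h1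
    (Eventually.of_forall fun n => ?_)
  have h2 : (∑ k ∈ Finset.range n, inner 𝕜 (v k) x • v k,
      ∑ k ∈ Finset.range n, inner 𝕜 (v k) y • v k) =
      ∑ k ∈ Finset.range n, inner 𝕜 (v k) x • (v k, (lam k : 𝕜) • v k) := by
    ext
    · simp [Prod.fst_sum]
    · simp only [Prod.snd_sum, Prod.smul_snd, h, smul_smul, mul_comm]
  rw [h2]
  exact Submodule.sum_mem _ fun k _ => Submodule.smul_mem _ _ (hv k)

end Operator

/-! ### The source and its Duhamel terms -/

section Data

variable {𝕜 H : Type*} [RCLike 𝕜] [NormedAddCommGroup H] [InnerProductSpace 𝕜 H]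
  {lam : ℕ → ℝ} {v : HilbertBasis ℕ 𝕜 H} {ρ T ε : ℝ} {f : ℝ → H}

lemma inner_pow (hlam : ∀ k, 0 < lam k) {τ : ℝ} {h : H} (hh : h ∈ powDomain lam v τ) (k : ℕ) :
    inner 𝕜 (v k) (pow lam v τ h) = ((lam k ^ τ : ℝ) : 𝕜) * inner 𝕜 (v k) h := by
  obtain ⟨x, hx⟩ := exists_inner_eq v (a := fun k => ((lam k ^ τ : ℝ) : 𝕜) * inner 𝕜 (v k) h) (by
    refine Summable.congr hh fun k => ?_
    rw [norm_mul, mul_pow, RCLike.norm_ofReal, sq_abs, ← Real.rpow_natCast (lam k ^ τ),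
      ← Real.rpow_mul (hlam k).le]
    congr 2
    push_cast
    ring)
  have h1 := hasSum_inner_smul v x
  simp only [hx] at h1
  rw [pow, h1.tsum_eq, hx]

lemma continuousOn_inner_of_powDomain (hlam : ∀ k, 0 < lam k)
    (hf : ContinuousInPowDomain lam v ε T f) (k : ℕ) :
    ContinuousOn (fun t => inner 𝕜 (v k) (f t)) (Icc 0 T) := by
  have h1 : ContinuousOn (fun t => ((lam k ^ ε : ℝ) : 𝕜)⁻¹ *
      inner 𝕜 (v k) (pow lam v ε (f t))) (Icc 0 T) :=
    continuousOn_const.mul (continuousOn_const.inner hf.2)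
  refine h1.congr fun t ht => ?_
  have h0 : ((lam k ^ ε : ℝ) : 𝕜) ≠ 0 :=
    RCLike.ofReal_ne_zero.mpr (Real.rpow_pos_of_pos (hlam k) _).ne'
  simp only
  rw [inner_pow hlam (hf.1 t ht), inv_mul_cancel_left₀ h0]

lemma continuousOn_of_powDomain (hlam : ∀ k, 0 < lam k) (hmono : Monotone lam) (hε : 0 ≤ ε)
    (hf : ContinuousInPowDomain lam v ε T f) : ContinuousOn f (Icc 0 T) := by
  refine UniformSqTail.continuousOn v (p := fun k t => inner 𝕜 (v k) (f t)) ?_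
    (continuousOn_inner_of_powDomain hlam hf) fun _ _ _ => rfl
  refine (UniformSqTail.of_continuousOn v isCompact_Icc hf.2).of_norm_le
    (B := (lam 0 ^ ε)⁻¹) fun k t ht => ?_
  have h0 : 0 < lam 0 ^ ε := Real.rpow_pos_of_pos (hlam 0) _
  have h1 : lam 0 ^ ε ≤ lam k ^ ε :=
    Real.rpow_le_rpow (hlam 0).le (hmono (Nat.zero_le k)) hε
  rw [inner_pow hlam (hf.1 t ht), norm_mul, RCLike.norm_ofReal, abs_of_pos (h0.trans_le h1),
    le_inv_mul_iff₀ h0]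
  exact mul_le_mul_of_nonneg_right h1 (norm_nonneg _)

lemma duhamel_eq_conv (k : ℕ) (t : ℝ) :
    duhamel ρ lam v f k t = conv (relaxKernel ρ (lam k)) (fun s => inner 𝕜 (v k) (f s)) t := by
  unfold duhamel conv
  simp only [RCLike.real_smul_eq_coe_mul, relaxKernel]

/-- On the critical indices the source vanishes, and so do the Duhamel terms. -/
lemma duhamel_eq_zero {k : ℕ} (h : ∀ t ∈ Ioc 0 T, inner 𝕜 (v k) (f t) = 0) {t : ℝ}
    (ht : t ∈ Icc 0 T) : duhamel ρ lam v f k t = 0 := by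
  rw [duhamel_eq_conv, conv_congr (k := fun _ => (0 : 𝕜)) ht.1 (fun _ _ => rfl)
    fun s hs => h s ⟨hs.1, hs.2.le.trans ht.2⟩]
  simp [conv]

/-- The Duhamel terms lie in `D(A)`, uniformly in time: by Minkowski's inequality the tails of
`λ_k ω_k(t)` are at most `∫₀ᵗ C η^(ρ ε - 1) dη` times the largest tail of `A^ε f`. -/
lemma uniformSqTail_lam_mul_duhamel [NormedSpace ℝ H] [CompleteSpace H] (hlam : ∀ k, 0 < lam k)
    (hρ : ρ ∈ Ioo (0 : ℝ) 1) (hε : ε ∈ Ioo (0 : ℝ) 1)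
    (hf : ContinuousInPowDomain lam v ε T f) :
    UniformSqTail (fun k t => (lam k : 𝕜) * duhamel ρ lam v f k t) (Icc 0 T) := fun δ hδ => by
  obtain ⟨C, hC, hCg⟩ := exists_lam_mul_relaxKernel_le hρ hε
  have hρε : 0 < ρ * ε := mul_pos hρ.1 hε.1
  have hbi : ∀ a b, IntervalIntegrable (fun η : ℝ => C * η ^ (ρ * ε - 1)) volume a b :=
    fun a b => (intervalIntegral.intervalIntegrable_rpow' (by linarith)).const_mul _
  set B := ∫ η in (0 : ℝ)..T, C * η ^ (ρ * ε - 1) with hB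
  set δ' := Real.sqrt δ / (|B| + 1) with hδ'
  have hδ'0 : 0 < δ' := by positivity
  obtain ⟨N, hN⟩ := UniformSqTail.of_continuousOn v isCompact_Icc hf.2 (δ' ^ 2) (by positivity)
  refine ⟨N, fun F hF t ht => ?_⟩
  have hfk := continuousOn_inner_of_powDomain hlam hf
  set G : ℕ → ℝ → H := fun k η =>
    ((lam k : 𝕜) * (relaxKernel ρ (lam k) η • inner 𝕜 (v k) (f (t - η)))) • v k with hG
  have hGi : ∀ k, IntervalIntegrable (G k) volume 0 t := fun k => by
    have h1 := ((intervalIntegrable_conv_integrand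
      (intervalIntegrable_relaxKernel (lam k) hρ.1 0 T) (hfk k) ht).const_mul (lam k : 𝕜))
    exact h1.smul_continuousOn continuousOn_const
  have hsum : ∑ k ∈ F, ((lam k : 𝕜) * duhamel ρ lam v f k t) • v k =
      ∫ η in (0 : ℝ)..t, ∑ k ∈ F, G k η := by
    rw [intervalIntegral.integral_finsetSum fun k _ => hGi k]
    refine Finset.sum_congr rfl fun k _ => ?_
    rw [duhamel_eq_conv, hG]
    simp only
    rw [intervalIntegral.integral_smul_const, intervalIntegral.integral_const_mul]
    rfl
  have hpt : ∀ η ∈ Ioo 0 t, ‖∑ k ∈ F, G k η‖ ≤ C * η ^ (ρ * ε - 1) * δ' := fun η hη => by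
    have hη0 : 0 ≤ C * η ^ (ρ * ε - 1) := mul_nonneg hC.le (Real.rpow_nonneg hη.1.le _)
    have hmem : t - η ∈ Icc 0 T := ⟨by linarith [hη.2], by linarith [hη.1, ht.2]⟩
    refine le_of_sq_le_sq ?_ (by positivity)
    rw [norm_sum_smul_sq, mul_pow]
    refine le_trans ?_ (mul_le_mul_of_nonneg_left (hN F hF _ hmem) (by positivity))
    rw [Finset.mul_sum]
    refine Finset.sum_le_sum fun k _ => ?_
    rw [← mul_pow]
    refine pow_le_pow_left₀ (norm_nonneg _) ?_ 2
    have hg := (relaxKernel_pos (lam k) hρ hη.1).le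
    beta_reduce
    rw [inner_pow hlam (hf.1 _ hmem), norm_mul, norm_mul, norm_smul, RCLike.norm_ofReal,
      RCLike.norm_ofReal, abs_of_pos (hlam k), abs_of_pos (Real.rpow_pos_of_pos (hlam k) ε),
      Real.norm_of_nonneg hg, ← mul_assoc, ← mul_assoc]
    exact mul_le_mul_of_nonneg_right (hCg _ _ (hlam k) hη.1) (norm_nonneg _)
  have hnorm : ‖∑ k ∈ F, ((lam k : 𝕜) * duhamel ρ lam v f k t) • v k‖ ≤ Real.sqrt δ := by
    rw [hsum]
    have hae : ∀ᵐ η ∂volume, η ∈ Ioc 0 t → ‖∑ k ∈ F, G k η‖ ≤ C * η ^ (ρ * ε - 1) * δ' := by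
      filter_upwards [compl_mem_ae_iff.mpr (measure_singleton t)] with η hη hη'
      exact hpt η ⟨hη'.1, lt_of_le_of_ne hη'.2 hη⟩
    calc _ ≤ ∫ η in (0 : ℝ)..t, C * η ^ (ρ * ε - 1) * δ' :=
          intervalIntegral.norm_integral_le_of_norm_le ht.1 hae ((hbi 0 t).mul_const δ')
      _ = (∫ η in (0 : ℝ)..t, C * η ^ (ρ * ε - 1)) * δ' :=
          intervalIntegral.integral_mul_const _ _
      _ ≤ B * δ' := by
          refine mul_le_mul_of_nonneg_right ?_ hδ'0.le
          refine intervalIntegral.integral_mono_interval le_rfl ht.1 ht.2 ?_ (hbi 0 T)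
          refine (ae_restrict_iff' measurableSet_Ioc).mpr (Eventually.of_forall fun η hη => ?_)
          exact mul_nonneg hC.le (Real.rpow_nonneg hη.1.le _)
      _ ≤ (|B| + 1) * δ' := mul_le_mul_of_nonneg_right (by linarith [le_abs_self B]) hδ'0.le
      _ = Real.sqrt δ := by
          rw [hδ']
          field_simp
  rw [← norm_sum_smul_sq v, ← Real.sq_sqrt hδ.le]
  exact pow_le_pow_left₀ (norm_nonneg _) hnorm 2

end Data

/-! ### The forward and the inverse problem -/

section Problem

variable {𝕜 H : Type*} [RCLike 𝕜] [NormedAddCommGroup H] [InnerProductSpace 𝕜 H]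
  [NormedSpace ℝ H] [CompleteSpace H] {A : H →ₗ.[𝕜] H} {lam : ℕ → ℝ} {v : HilbertBasis ℕ 𝕜 H}
  {ρ T α ξ₀ ξ₂ ε : ℝ} {f : ℝ → H} {W : H}

/-- Every solution of the forward problem is given, coefficient by coefficient, by Duhamel's
formula. -/
lemma IsForwardSolution.inner_eq (hA : IsSelfAdjoint A)
    (hlam : ∀ k, 0 < lam k) (hv : ∀ k, (v k, (lam k : 𝕜) • v k) ∈ A.graph)
    (hρ : ρ ∈ Ioo (0 : ℝ) 1) (hT : 0 < T) (hf : ContinuousInPowDomain lam v ε T f)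
    {u : ℝ → H} {φ : H} (hu : IsForwardSolution A ρ T α ξ₀ f u φ) (k : ℕ) {t : ℝ}
    (ht : t ∈ Icc 0 T) :
    inner 𝕜 (v k) (u t) = relax ρ (lam k) t • inner 𝕜 (v k) (u 0) + duhamel ρ lam v f k t := by
  obtain ⟨Du, Au, -, -, heq⟩ := hu.equation
  have hfk := continuousOn_inner_of_powDomain hlam hf k
  have huk : ContinuousOn (fun s => inner 𝕜 (v k) (u s)) (Icc 0 T) :=
    continuousOn_const.inner hu.continuousOn
  have i1 : IntervalIntegrable (fun _ : ℝ => (1 : ℝ)) volume 0 T := intervalIntegrable_const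
  rw [duhamel_eq_conv]
  refine eq_duhamel_of_integrated_equation hρ hT huk hfk (fun s hs => ?_) ht
  have hd : ∀ s ∈ Ioc 0 T, HasCaputoDeriv ρ T (fun s => inner 𝕜 (v k) (u s))
      (inner 𝕜 (v k) (f s) - lam k • inner 𝕜 (v k) (u s)) s := fun s hs => by
    obtain ⟨h1, h2, h3⟩ := heq s hs
    have h4 := h1.clm_comp ((innerSL 𝕜 (v k)).restrictScalars ℝ) hρ.2 hu.continuousOn
      (Ioc_subset_Icc_self hs)
    have h5 : inner 𝕜 (v k) (f s) - lam k • inner 𝕜 (v k) (u s) = inner 𝕜 (v k) (Du s) := by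
      rw [← h3, inner_add_right, inner_eq_of_mem_graph hA hv h2 k, RCLike.real_smul_eq_coe_mul,
        add_sub_cancel_right]
    rw [h5]
    exact h4
  rw [conv_eq_of_hasCaputoDeriv (d := fun s => inner 𝕜 (v k) (f s) - lam k • inner 𝕜 (v k) (u s))
      hρ.2 huk (hfk.sub (huk.const_smul (lam k))) hd hs,
    conv_sub (k := fun s => lam k • inner 𝕜 (v k) (u s)) i1 hfk (huk.const_smul (lam k)) hs,
    conv_smul, sub_add_cancel]

/-- The coefficient of `u(0)` that the observation `u(ξ₂) = W` enforces. -/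
def initCoeff (ρ ξ₂ : ℝ) (lam : ℕ → ℝ) (v : HilbertBasis ℕ 𝕜 H) (f : ℝ → H) (W : H) (k : ℕ) : 𝕜 :=
  (relax ρ (lam k) ξ₂)⁻¹ • (inner 𝕜 (v k) W - duhamel ρ lam v f k ξ₂)

/-- The initial coefficients are square summable: dividing by `E_ρ(-λ_k ξ₂^ρ)` costs one power
of `λ_k`, which is available because `W` and the Duhamel terms lie in `D(A)`. -/
lemma summable_norm_initCoeff_sq (hA : IsSelfAdjoint A) (hlam : ∀ k, 0 < lam k)
    (hmono : Monotone lam) (hv : ∀ k, (v k, (lam k : 𝕜) • v k) ∈ A.graph)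
    (hρ : ρ ∈ Ioo (0 : ℝ) 1) (hξ₂ : ξ₂ ∈ Ioc 0 T) (hε : ε ∈ Ioo (0 : ℝ) 1)
    (hf : ContinuousInPowDomain lam v ε T f) (hW : W ∈ A.domain) :
    Summable fun k => ‖initCoeff ρ ξ₂ lam v f W k‖ ^ 2 := by
  have hΓ := Real.Gamma_pos_of_pos (sub_pos.mpr hρ.2)
  have h1 : UniformSqTail (fun k _ => (lam k : 𝕜) * inner 𝕜 (v k) W) {ξ₂} := by
    refine UniformSqTail.of_summable
      (v.orthonormal.inner_products_summable (A ⟨W, hW⟩)) fun k _ _ => ?_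
    rw [inner_eq_of_mem_graph hA hv (A.mem_graph ⟨W, hW⟩) k]
  have h2 : UniformSqTail (fun k t => (-1 : 𝕜) * ((lam k : 𝕜) * duhamel ρ lam v f k t)) {ξ₂} := by
    refine UniformSqTail.of_norm_le (B := 1)
      (p := fun k t => (lam k : 𝕜) * duhamel ρ lam v f k t) (fun δ hδ => ?_) fun k t _ => by simp
    obtain ⟨N, hN⟩ := uniformSqTail_lam_mul_duhamel hlam hρ hε hf δ hδ
    refine ⟨N, fun F hF t ht => hN F hF t ?_⟩
    rw [mem_singleton_iff.mp ht]
    exact Ioc_subset_Icc_self hξ₂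
  have h3 := (h1.add h2).of_norm_le (q := fun k _ => initCoeff ρ ξ₂ lam v f W k)
    (B := (lam 0)⁻¹ + Real.Gamma (1 - ρ) * ξ₂ ^ ρ) (fun k t ht => by
      rw [mem_singleton_iff.mp ht]
      have e1 : (lam k : 𝕜) * inner 𝕜 (v k) W + (-1 : 𝕜) * ((lam k : 𝕜) *
          duhamel ρ lam v f k ξ₂) =
          (lam k : 𝕜) * (inner 𝕜 (v k) W - duhamel ρ lam v f k ξ₂) := by ring
      have hr := relax_pos (lam k) hρ hξ₂.1.le
      rw [e1, initCoeff, norm_smul, norm_mul, RCLike.norm_ofReal, abs_of_pos (hlam k), norm_inv,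
        Real.norm_of_nonneg hr.le, ← mul_assoc]
      refine mul_le_mul_of_nonneg_right ?_ (norm_nonneg _)
      have h4 : 1 ≤ (lam 0)⁻¹ * lam k := by
        rw [← div_eq_inv_mul, one_le_div (hlam 0)]
        exact hmono (Nat.zero_le k)
      linarith [inv_relax_le hρ (hlam k).le hξ₂.1])
  exact h3.summable (mem_singleton ξ₂)

/-- Existence for square summable initial coefficients. The part `∑ λ_k e_k(t) c_k v_k` of
`A u(t)` is continuous on `(0, T]` only, with the integrable bound `C t^(-ρ)`; this is enough to
integrate the equation from `0`. -/
lemma exists_solution (hA : IsSelfAdjoint A) (hlam : ∀ k, 0 < lam k)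
    (hmono : Monotone lam) (hv : ∀ k, (v k, (lam k : 𝕜) • v k) ∈ A.graph)
    (hρ : ρ ∈ Ioo (0 : ℝ) 1) (hT : 0 < T) (hε : ε ∈ Ioo (0 : ℝ) 1)
    (hf : ContinuousInPowDomain lam v ε T f) {c : ℕ → 𝕜} (hc : Summable fun k => ‖c k‖ ^ 2) :
    ∃ u : ℝ → H, ContinuousOn u (Icc 0 T) ∧
      (∃ Du Au : ℝ → H, ContinuousOn Du (Ioc 0 T) ∧ ContinuousOn Au (Ioc 0 T) ∧
        ∀ t ∈ Ioc 0 T, HasCaputoDeriv ρ T u (Du t) t ∧ (u t, Au t) ∈ A.graph ∧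
          Du t + Au t = f t) ∧
      ∀ t ∈ Icc 0 T, ∀ k,
        inner 𝕜 (v k) (u t) = relax ρ (lam k) t • c k + duhamel ρ lam v f k t := by
  have hfk := continuousOn_inner_of_powDomain hlam hf
  have hfc := continuousOn_of_powDomain hlam hmono hε.1.le hf
  have hωc : ∀ k, ContinuousOn (duhamel ρ lam v f k) (Icc 0 T) := fun k => by
    have := continuousOn_conv hT.le (intervalIntegrable_relaxKernel (lam k) hρ.1 0 T) (hfk k)
    exact this.congr fun t _ => duhamel_eq_conv k t
  have hrc : ∀ k, Continuous fun t => relax ρ (lam k) t • c k := fun k =>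
    (continuous_relax (lam k) hρ.1).smul continuous_const
  have tA2 := uniformSqTail_lam_mul_duhamel hlam hρ hε hf
  have tω : UniformSqTail (duhamel ρ lam v f) (Icc 0 T) :=
    tA2.of_norm_le (B := (lam 0)⁻¹) fun k t _ => by
      rw [norm_mul, RCLike.norm_ofReal, abs_of_pos (hlam k), le_inv_mul_iff₀ (hlam 0)]
      exact mul_le_mul_of_nonneg_right (hmono (Nat.zero_le k)) (norm_nonneg _)
  have tr : UniformSqTail (fun k t => relax ρ (lam k) t • c k) (Icc 0 T) :=
    UniformSqTail.of_summable hc fun k t ht => by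
      rw [norm_smul, Real.norm_of_nonneg (relax_pos (lam k) hρ ht.1).le]
      exact mul_le_of_le_one_left (norm_nonneg _) (relax_le_one hρ (hlam k).le ht.1)
  have tu := tr.add tω
  have hu : ∀ t, ∃ x : H, t ∈ Icc 0 T → ∀ k,
      inner 𝕜 (v k) x = relax ρ (lam k) t • c k + duhamel ρ lam v f k t := fun t => by
    by_cases ht : t ∈ Icc 0 T
    · obtain ⟨x, hx⟩ := exists_inner_eq v (tu.summable ht)
      exact ⟨x, fun _ => hx⟩
    · exact ⟨0, fun h => absurd h ht⟩
  choose u hu using hu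
  have cu : ContinuousOn u (Icc 0 T) :=
    tu.continuousOn v (fun k => (hrc k).continuousOn.add (hωc k)) hu
  -- `A2` is the part `∑ λ_k ω_k(t) v_k` of `A u`, continuous up to `t = 0`.
  have hA2 : ∀ t, ∃ x : H, t ∈ Icc 0 T → ∀ k,
      inner 𝕜 (v k) x = (lam k : 𝕜) * duhamel ρ lam v f k t := fun t => by
    by_cases ht : t ∈ Icc 0 T
    · obtain ⟨x, hx⟩ := exists_inner_eq v (tA2.summable ht)
      exact ⟨x, fun _ => hx⟩
    · exact ⟨0, fun h => absurd h ht⟩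
  choose A2 hA2 using hA2
  have cA2 : ContinuousOn A2 (Icc 0 T) :=
    tA2.continuousOn v (fun k => continuousOn_const.mul (hωc k)) hA2
  -- `A1` is the part `∑ λ_k e_k(t) c_k v_k`, of size `t^(-ρ)` as `t → 0`.
  set K := (Real.Gamma (2 - ρ))⁻¹ with hK
  have hK0 : 0 < K := inv_pos.mpr (Real.Gamma_pos_of_pos (by linarith [hρ.2]))
  have bA1 : ∀ k, ∀ t : ℝ, 0 < t →
      ‖(lam k : 𝕜) * (relax ρ (lam k) t • c k)‖ ≤ K * t ^ (-ρ) * ‖c k‖ := fun k t ht => by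
    rw [norm_mul, norm_smul, RCLike.norm_ofReal, abs_of_pos (hlam k),
      Real.norm_of_nonneg (relax_pos (lam k) hρ ht.le).le, ← mul_assoc]
    exact mul_le_mul_of_nonneg_right (lam_mul_relax_le hρ (hlam k).le ht) (norm_nonneg _)
  have tA1 : ∀ δ : ℝ, 0 < δ →
      UniformSqTail (fun k t => (lam k : 𝕜) * (relax ρ (lam k) t • c k)) (Icc δ T) :=
    fun δ hδ => by
      refine (UniformSqTail.of_summable (p := fun k _ => c k) hc fun k _ _ => le_rfl).of_norm_le
        (B := K * δ ^ (-ρ)) fun k t ht => (bA1 k t (hδ.trans_le ht.1)).trans ?_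
      refine mul_le_mul_of_nonneg_right (mul_le_mul_of_nonneg_left ?_ hK0.le) (norm_nonneg _)
      exact Real.rpow_le_rpow_of_nonpos hδ ht.1 (by linarith [hρ.1])
  have hA1 : ∀ t, ∃ x : H, t ∈ Ioc 0 T → ∀ k,
      inner 𝕜 (v k) x = (lam k : 𝕜) * (relax ρ (lam k) t • c k) := fun t => by
    by_cases ht : t ∈ Ioc 0 T
    · obtain ⟨x, hx⟩ := exists_inner_eq v ((tA1 t ht.1).summable ⟨le_rfl, ht.2⟩)
      exact ⟨x, fun _ => hx⟩
    · exact ⟨0, fun h => absurd h ht⟩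
  choose A1 hA1 using hA1
  have cA1 : ContinuousOn A1 (Ioc 0 T) := fun t ht => by
    have h0 : 0 < t / 2 := half_pos ht.1
    have h1 := (tA1 (t / 2) h0).continuousOn v (P := A1)
      (fun k => (continuous_const.mul (hrc k)).continuousOn)
      fun s hs => hA1 s ⟨h0.trans_le hs.1, hs.2⟩
    refine (h1 t ⟨(half_lt_self ht.1).le, ht.2⟩).mono_of_mem_nhdsWithin ?_
    filter_upwards [self_mem_nhdsWithin,
      mem_nhdsWithin_of_mem_nhds (Ioi_mem_nhds (half_lt_self ht.1))] with s hs hs'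
      using ⟨le_of_lt hs', hs.2⟩
  obtain ⟨y, hy⟩ := exists_inner_eq v hc
  have iA1 : IntervalIntegrable A1 volume 0 T := by
    have hb : IntervalIntegrable (fun s : ℝ => K * s ^ (-ρ) * ‖y‖) volume 0 T :=
      ((intervalIntegral.intervalIntegrable_rpow' (by linarith [hρ.2])).const_mul K).mul_const _
    rw [intervalIntegrable_iff_integrableOn_Ioc_of_le hT.le] at hb ⊢
    refine hb.mono' (cA1.aestronglyMeasurable measurableSet_Ioc) ?_
    refine (ae_restrict_iff' measurableSet_Ioc).mpr (Eventually.of_forall fun s hs => ?_)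
    refine norm_le_of_norm_inner_le v (mul_nonneg hK0.le (Real.rpow_nonneg hs.1.le _))
      fun k => ?_
    rw [hA1 s hs, hy]
    exact bA1 k s hs.1
  have iD : IntervalIntegrable (fun s => f s - (A1 s + A2 s)) volume 0 T := by
    have hI : uIcc 0 T = Icc 0 T := uIcc_of_le hT.le
    exact (hI ▸ hfc).intervalIntegrable.sub (iA1.add (hI ▸ cA2).intervalIntegrable)
  have cD : ContinuousOn (fun s => f s - (A1 s + A2 s)) (Ioc 0 T) :=
    (hfc.mono Ioc_subset_Icc_self).sub (cA1.add (cA2.mono Ioc_subset_Icc_self))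
  have hinner : ∀ t ∈ Ioc 0 T, ∀ k,
      inner 𝕜 (v k) (A1 t + A2 t) = (lam k : 𝕜) * inner 𝕜 (v k) (u t) := fun t ht k => by
    rw [inner_add_right, hA1 t ht, hA2 t (Ioc_subset_Icc_self ht), hu t (Ioc_subset_Icc_self ht),
      mul_add]
  refine ⟨u, cu, ⟨fun s => f s - (A1 s + A2 s), fun s => A1 s + A2 s, cD,
    cA1.add (cA2.mono Ioc_subset_Icc_self), fun t ht =>
      ⟨?_, mem_graph_of_inner_eq hA hv (hinner t ht), sub_add_cancel _ _⟩⟩, hu⟩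
  -- Both sides of the integrated equation lie in `H`, so comparing Fourier coefficients suffices.
  refine hasCaputoDeriv_of_conv_eq (d := fun s => f s - (A1 s + A2 s)) cD iD (fun s hs => ?_) ht
  refine eq_of_inner_eq v fun k => ?_
  have ik := intervalIntegrable_fracKernel (sub_pos.mpr hρ.2) 0 T
  have i1 : IntervalIntegrable (fun _ : ℝ => (1 : ℝ)) volume 0 T := intervalIntegrable_const
  have h0 : ∀ r ∈ Icc 0 T, inner 𝕜 (v k) (u r) = relax ρ (lam k) r • c k +
      conv (relaxKernel ρ (lam k)) (fun s => inner 𝕜 (v k) (f s)) r := fun r hr => by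
    rw [hu r hr, duhamel_eq_conv]
  have huk : ContinuousOn (fun s => inner 𝕜 (v k) (u s)) (Icc 0 T) :=
    continuousOn_const.inner cu
  have h1 : inner 𝕜 (v k) (conv (fracKernel (1 - ρ)) (fun s => u s - u 0) s) =
      conv (fracKernel (1 - ρ)) (fun r => relax ρ (lam k) r • c k +
        conv (relaxKernel ρ (lam k)) (fun s => inner 𝕜 (v k) (f s)) r - c k) s := by
    have h2 := conv_clm (h := fun s => u s - u 0) ((innerSL 𝕜 (v k)).restrictScalars ℝ) ik
      (cu.sub continuousOn_const) hs
    refine h2.symm.trans (conv_congr hs.1 (fun _ _ => rfl) fun r hr => ?_)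
    change inner 𝕜 (v k) (u r - u 0) = _
    rw [inner_sub_right, h0 r ⟨hr.1.le, hr.2.le.trans hs.2⟩, h0 0 ⟨le_rfl, hT.le⟩,
      relax_zero _ hρ.1, conv_zero_right, one_smul, add_zero]
  have h3 : inner 𝕜 (v k) (conv (fun _ => 1) (fun s => f s - (A1 s + A2 s)) s) =
      conv (fun _ => 1) (fun r => inner 𝕜 (v k) (f r)) s -
        lam k • conv (fun _ => 1) (fun r => inner 𝕜 (v k) (u r)) s := by
    have h4 := ((innerSL 𝕜 (v k)).restrictScalars ℝ).intervalIntegral_comp_comm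
      (iD.mono_set (show uIcc 0 s ⊆ uIcc 0 T by
        rw [uIcc_of_le hs.1, uIcc_of_le hT.le]
        exact Icc_subset_Icc_right hs.2))
    rw [conv_one]
    refine h4.symm.trans ?_
    rw [← conv_smul, ← conv_sub (k := fun s => lam k • inner 𝕜 (v k) (u s)) i1 (hfk k)
      (huk.const_smul (lam k)) hs, ← conv_one]
    refine conv_congr hs.1 (fun _ _ => rfl) fun r hr => ?_
    change inner 𝕜 (v k) (f r - (A1 r + A2 r)) = _
    rw [inner_sub_right, hinner r ⟨hr.1, hr.2.le.trans hs.2⟩, RCLike.real_smul_eq_coe_mul]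
  have h5 := integrated_equation_of_duhamel (lam k) hρ hT.le (c k) (hfk k) hs
  have h6 : conv (fun _ => 1) (fun r => inner 𝕜 (v k) (u r)) s =
      conv (fun _ => 1) (fun r => relax ρ (lam k) r • c k +
        conv (relaxKernel ρ (lam k)) (fun s => inner 𝕜 (v k) (f s)) r) s :=
    conv_congr hs.1 (fun _ _ => rfl) fun r hr => h0 r ⟨hr.1.le, hr.2.le.trans hs.2⟩
  rw [h1, h3, h6, eq_sub_iff_add_eq]
  exact h5

/-- A single mode `e_k(t) v_k` solves the homogeneous equation. -/
lemma hasCaputoDeriv_relax_smul (hρ : ρ ∈ Ioo (0 : ℝ) 1) (l : ℝ) (x : H) {t : ℝ}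
    (ht : t ∈ Ioc 0 T) :
    HasCaputoDeriv ρ T (fun s => relax ρ l s • x) ((-l * relax ρ l t) • x) t := by
  have hc : Continuous fun s => (-l * relax ρ l s) • x :=
    (continuous_const.mul (continuous_relax l hρ.1)).smul continuous_const
  refine hasCaputoDeriv_of_conv_eq (d := fun s => (-l * relax ρ l s) • x) hc.continuousOn
    (hc.intervalIntegrable 0 T) (fun s hs => ?_) ht
  rcases hs.1.eq_or_lt with h0 | h0
  · simp [← h0]
  simp only [relax_zero l hρ.1, ← sub_smul]
  rw [conv_smul_const, conv_smul_const, conv_fracKernel_relax_sub_one l hρ h0]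
  congr 1
  exact (conv_smul (-l) _ _ s).symm

/-- In the critical case the mode `e_k(t) v_k` satisfies the homogeneous nonlocal condition, so
it can be added to any solution of the forward problem. -/
lemma IsForwardSolution.add_critical_mode
    (hv : ∀ k, (v k, (lam k : 𝕜) • v k) ∈ A.graph) (hρ : ρ ∈ Ioo (0 : ℝ) 1) {k : ℕ}
    (hk : k ∈ criticalSet ρ α ξ₀ lam) {u : ℝ → H} {φ : H}
    (hu : IsForwardSolution A ρ T α ξ₀ f u φ) :
    IsForwardSolution A ρ T α ξ₀ f (fun t => u t + relax ρ (lam k) t • v k) φ := by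
  obtain ⟨Du, Au, cD, cA, heq⟩ := hu.equation
  have ce := continuous_relax (lam k) hρ.1
  have cm : Continuous fun t => relax ρ (lam k) t • v k := ce.smul continuous_const
  refine ⟨hu.continuousOn.add cm.continuousOn,
    ⟨fun t => Du t + (-lam k * relax ρ (lam k) t) • v k,
    fun t => Au t + (lam k * relax ρ (lam k) t) • v k, ?_, ?_, fun t ht => ?_⟩, ?_⟩
  · exact cD.add ((continuous_const.mul ce).smul continuous_const).continuousOn
  · exact cA.add ((continuous_const.mul ce).smul continuous_const).continuousOn
  · obtain ⟨h1, h2, h3⟩ := heq t ht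
    refine ⟨h1.add hρ.2 hu.continuousOn cm.continuousOn (Ioc_subset_Icc_self ht)
      (hasCaputoDeriv_relax_smul hρ _ _ ht), ?_, ?_⟩
    · have h4 := A.graph.add_mem h2 (A.graph.smul_mem ((relax ρ (lam k) t : ℝ) : 𝕜) (hv k))
      have h5 : (lam k * relax ρ (lam k) t) • v k =
          ((relax ρ (lam k) t : ℝ) : 𝕜) • (lam k : 𝕜) • v k := by
        rw [RCLike.real_smul_eq_coe_smul (K := 𝕜), smul_smul, mul_comm, RCLike.ofReal_mul]
      beta_reduce
      rw [h5, RCLike.real_smul_eq_coe_smul (K := 𝕜)]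
      exact h4
    · beta_reduce
      rw [← h3, neg_mul, neg_smul]
      abel
  · have h6 : relax ρ (lam k) ξ₀ = α := hk
    rw [hu.nonlocal_condition, h6, relax_zero _ hρ.1, one_smul,
      RCLike.real_smul_eq_coe_smul (K := 𝕜), smul_add]
    abel

end Problem

end Subdiffusion

end

theorem theorem2 {𝕜 H : Type*} [RCLike 𝕜] [NormedAddCommGroup H] [InnerProductSpace 𝕜 H]
    [NormedSpace ℝ H] [CompleteSpace H]
    -- the positive self-adjoint operator, its eigenvalues and its eigenbasis
    (A : H →ₗ.[𝕜] H) (hA : IsSelfAdjoint A)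
    (lam : ℕ → ℝ) (hlam_pos : ∀ k, 0 < lam k) (hlam_mono : Monotone lam)
    (hlam_lim : Tendsto lam atTop atTop)
    (v : HilbertBasis ℕ 𝕜 H) (hv : ∀ k, (v k, (lam k : 𝕜) • v k) ∈ A.graph)
    (ρ T α ξ₀ ξ₂ ε : ℝ) (hρ : ρ ∈ Ioo (0 : ℝ) 1) (hT : 0 < T) (hα : α ∈ Ioo (0 : ℝ) 1)
    (hξ₀ : ξ₀ ∈ Ioc 0 T) (hξ₂ : ξ₂ ∈ Ioc 0 T) (hne : ξ₂ ≠ ξ₀) (hε : ε ∈ Ioo (0 : ℝ) 1)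
    (W : H) (hW : W ∈ A.domain)
    (f : ℝ → H) (hf : Subdiffusion.ContinuousInPowDomain lam v ε T f)
    (horth : ∀ k ∈ Subdiffusion.criticalSet ρ α ξ₀ lam, ∀ t ∈ Ioc 0 T, inner 𝕜 (v k) (f t) = 0) :
    -- the inverse problem has a unique solution, given by the series
    (∃ (u : ℝ → H) (φ : H),
      Subdiffusion.IsInverseSolution A ρ T α ξ₀ ξ₂ f W u φ ∧
      (∀ (u' : ℝ → H) (φ' : H), Subdiffusion.IsInverseSolution A ρ T α ξ₀ ξ₂ f W u' φ' →
        φ' = φ ∧ EqOn u' u (Icc 0 T)) ∧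
      HasSum (fun k : {k : ℕ // k ∉ Subdiffusion.criticalSet ρ α ξ₀ lam} =>
        (Subdiffusion.phiCoeff ρ α ξ₀ ξ₂ lam v f W k : 𝕜) • v k) φ ∧
      ∀ t ∈ Icc 0 T, HasSum (fun k : ℕ =>
        (Subdiffusion.uCoeff ρ α ξ₀ ξ₂ lam v f W φ t k : 𝕜) • v k) (u t)) ∧
    -- in the critical case a solution of the forward problem is never unique
    ((Subdiffusion.criticalSet ρ α ξ₀ lam).Nonempty →
      ∀ (u : ℝ → H) (φ : H), Subdiffusion.IsForwardSolution A ρ T α ξ₀ f u φ →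
        ∃ w : ℝ → H, Subdiffusion.IsForwardSolution A ρ T α ξ₀ f w φ ∧
          ¬ EqOn w u (Icc 0 T)) := by
  obtain ⟨u, cu, hu_eq, hu⟩ := Subdiffusion.exists_solution hA hlam_pos hlam_mono hv hρ hT hε hf
    (Subdiffusion.summable_norm_initCoeff_sq hA hlam_pos hlam_mono hv hρ hξ₂ hε hf hW)
  have m0 : (0 : ℝ) ∈ Icc 0 T := ⟨le_rfl, hT.le⟩
  have mξ₀ : ξ₀ ∈ Icc 0 T := Ioc_subset_Icc_self hξ₀
  have mξ₂ : ξ₂ ∈ Icc 0 T := Ioc_subset_Icc_self hξ₂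
  have hr₂ : ∀ k, (Subdiffusion.relax ρ (lam k) ξ₂ : 𝕜) ≠ 0 := fun k =>
    RCLike.ofReal_ne_zero.mpr (Subdiffusion.relax_pos (lam k) hρ hξ₂.1.le).ne'
  have hω : ∀ k ∈ Subdiffusion.criticalSet ρ α ξ₀ lam, ∀ t ∈ Icc 0 T,
      Subdiffusion.duhamel ρ lam v f k t = 0 := fun k hk t ht =>
    Subdiffusion.duhamel_eq_zero (horth k hk) ht
  have hrelax : ∀ k t, Subdiffusion.mittagLeffler ρ 1 (-(lam k) * t ^ ρ) =
      Subdiffusion.relax ρ (lam k) t := fun _ _ => rfl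
  simp only [Subdiffusion.initCoeff, RCLike.real_smul_eq_coe_mul, RCLike.ofReal_inv] at hu
  have hφ : ∀ k, inner 𝕜 (v k) (u ξ₀ - (α : 𝕜) • u 0) =
      ((Subdiffusion.relax ρ (lam k) ξ₀ : 𝕜) - α) * ((Subdiffusion.relax ρ (lam k) ξ₂ : 𝕜)⁻¹ *
        (inner 𝕜 (v k) W - Subdiffusion.duhamel ρ lam v f k ξ₂)) +
        Subdiffusion.duhamel ρ lam v f k ξ₀ := fun k => by
    rw [inner_sub_right, inner_smul_right, hu ξ₀ mξ₀, hu 0 m0, Subdiffusion.relax_zero _ hρ.1,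
      Subdiffusion.duhamel_eq_conv k 0, Subdiffusion.conv_zero_right, RCLike.ofReal_one]
    ring
  refine ⟨⟨u, u ξ₀ - (α : 𝕜) • u 0, ⟨⟨cu, hu_eq, (add_sub_cancel _ _).symm⟩, ?_⟩,
    fun u' φ' hu' => ?_, ?_, fun t ht => ?_⟩, ?_⟩
  · refine Subdiffusion.eq_of_inner_eq v fun k => ?_
    rw [hu ξ₂ mξ₂, mul_inv_cancel_left₀ (hr₂ k), sub_add_cancel]
  · have hform := fun (k : ℕ) (t : ℝ) (ht : t ∈ Icc 0 T) =>
      hu'.forward.inner_eq hA hlam_pos hv hρ hT hf k ht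
    have heq : EqOn u' u (Icc 0 T) := fun t ht => by
      refine Subdiffusion.eq_of_inner_eq v fun k => ?_
      have h2 := hform k ξ₂ mξ₂
      rw [hu'.observation, RCLike.real_smul_eq_coe_mul] at h2
      rw [hform k t ht, hu t ht, h2, add_sub_cancel_right, inv_mul_cancel_left₀ (hr₂ k),
        RCLike.real_smul_eq_coe_mul]
    refine ⟨?_, heq⟩
    rw [← heq mξ₀, ← heq m0, hu'.forward.nonlocal_condition, add_sub_cancel_left]
  · have hsum := Subdiffusion.hasSum_inner_smul v (u ξ₀ - (α : 𝕜) • u 0)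
    have hsupp : Function.support (fun k => inner 𝕜 (v k) (u ξ₀ - (α : 𝕜) • u 0) • v k) ⊆
        {k | k ∉ Subdiffusion.criticalSet ρ α ξ₀ lam} := fun k hk hcrit => hk (by
      have h1 : Subdiffusion.relax ρ (lam k) ξ₀ = α := hcrit
      simp only [hφ k, h1, sub_self, zero_mul, hω k hcrit ξ₀ mξ₀, add_zero, zero_smul])
    refine ((hasSum_subtype_iff_of_support_subset hsupp).mpr hsum).congr_fun fun k => ?_
    simp only [Function.comp_apply, hφ, Subdiffusion.phiCoeff, hrelax, RCLike.ofReal_div,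
      RCLike.ofReal_sub]
    congr 2
    ring
  · refine (Subdiffusion.hasSum_inner_smul v (u t)).congr_fun fun k => ?_
    congr 1
    rw [hu t ht, Subdiffusion.uCoeff]
    split_ifs with hk
    · rw [hω k hk t ht, hω k hk ξ₂ mξ₂, sub_zero, add_zero, hrelax, hrelax]
      ring
    · have h1 : (Subdiffusion.relax ρ (lam k) ξ₀ : 𝕜) - α ≠ 0 := by
        rw [← RCLike.ofReal_sub, RCLike.ofReal_ne_zero, sub_ne_zero]
        exact hk
      rw [hφ, add_sub_cancel_right, hrelax, hrelax, RCLike.ofReal_sub,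
        mul_div_cancel_left₀ _ h1]
      ring
  · rintro ⟨k, hk⟩ w φ hw
    refine ⟨_, hw.add_critical_mode hv hρ hk, fun h => ?_⟩
    -- the two solutions differ by `v k` at time `0`
    have h1 := h m0
    simp only [Subdiffusion.relax_zero _ hρ.1, one_smul, add_eq_left] at h1
    exact v.orthonormal.ne_zero k h1
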